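/- Let $k$ be an algebraically closed field of characteristic zero. (1) Let $X\subset\mathbb P^4_k$ be an (irreducible) cubic threefold that is not a cone, whose singular locus contains a plane, and such that no singular point of $X$ is fixed by the whole automorphism group $\mathrm{Aut}(X)$. Then $X$ is isomorphic, by a linear change of coordinates, to the cubic threefold $$X_0=\{x_1x_4^2+x_2x_4x_5+x_3x_5^2=0\}\subset\mathbb P^4_k .$$ (2) For every finite subgroup $G\subset\mathrm{Aut}(X_0)$, the action of $G$ on $X_0$ is linearizable: there is a $4$-dimensional linear representation $V$ of $G$ such that $X_0$ is $G$-equivariantly birational to $\mathbb P(V)=\mathbb P^3$. (The action on $\mathbb P(V)$ is not required to be generically free a priori.) (3) There are group homomorphisms $\rho:\mathrm{Aut}(X_0)\to\mathrm{GL}_2(k)$ and $\sigma:\mathrm{Aut}(X_0)\to\mathrm{GL}_3(k)$ such that $X_0$ is $\mathrm{Aut}(X_0)$-equivariantly birational to $\mathbb P^1\times\mathbb P^2$ with the action $g\cdot([y],[z])=([\rho(g)y],[\sigma(g)z])$ (which lifts to the trivial rank-$2$ vector bundle $\mathbb A^2\times\mathbb P^2\to\mathbb P^2$ by $g\cdot(y,[z])=(\rho(g)y,[\sigma(g)z])$),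 and such that every finite subgroup $G\subset\mathrm{Aut}(X_0)$ acts generically freely on $\mathbb P^2$ via $\sigma$, i.e. all points of some dense open subset of $\mathbb P^2$ have trivial stabilizer in $G$. Here two varieties with actions of a group $G$ are $G$-equivariantly birational if there is a birational map between them commuting with the actions of $G$. -/

import Mathlib

open scoped LinearAlgebra.Projectivization

/-!
Classical algebraic geometry over an algebraically closed field `k`. A point of projective space
is an element of `ℙ k (ι → k)`, with homogeneous coordinates indexed by the finite type `ι`;
varieties are Zariski (locally) closed sets of such points, and morphisms are maps that are
locally given by forms of the same degree.
-/

namespace ClassicalVariety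

variable {k : Type*} [Field k] {ι κ τ : Type*}

/-- The values of a family of polynomials at the chosen homogeneous coordinates of `p`.
For forms of the same degree these values are, up to a common nonzero factor, independent of
the choice. -/
noncomputable def values (f : κ → MvPolynomial ι k) (p : ℙ k (ι → k)) : κ → k :=
  fun j => MvPolynomial.eval p.rep (f j)

/-! ### Zariski topology -/

/-- The hypersurface `f = 0` in projective space (used for homogeneous `f`). -/
def hypersurface (f : MvPolynomial ι k) : Set (ℙ k (ι → k)) :=
  {p | MvPolynomial.eval p.rep f = 0}

/-- Zariski closed subsets: common zero sets of families of homogeneous polynomials. -/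
def IsZariskiClosed (Z : Set (ℙ k (ι → k))) : Prop :=
  ∃ S : Set (MvPolynomial ι k), (∀ f ∈ S, ∃ d, f.IsHomogeneous d) ∧ Z = ⋂ f ∈ S, hypersurface f

/-- `U` is a Zariski dense, relatively open subset of `X`. -/
def IsDenseOpen (X U : Set (ℙ k (ι → k))) : Prop :=
  (∃ Z, IsZariskiClosed Z ∧ U = X \ Z) ∧ ∀ Z, IsZariskiClosed Z → U ⊆ Z → X ⊆ Z

/-! ### Regular maps and automorphisms -/

/-- A map between subsets of projective spaces is regular if near every point it is given by
forms of the same degree without common zero there. -/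
def IsRegularMap {U : Set (ℙ k (ι → k))} {V : Set (ℙ k (κ → k))} (φ : U → V) : Prop :=
  ∀ p : U, ∃ (d : ℕ) (f : κ → MvPolynomial ι k), (∀ j, (f j).IsHomogeneous d) ∧
    values f p ≠ 0 ∧
    ∀ (q : U) (hq : values f q ≠ 0), (φ q : ℙ k (κ → k)) = Projectivization.mk k (values f q) hq

/-- A bijection is biregular (an isomorphism of varieties) if it and its inverse are regular. -/
def IsBiregular {U : Set (ℙ k (ι → k))} {V : Set (ℙ k (κ → k))} (φ : U ≃ V) : Prop :=
  IsRegularMap φ ∧ IsRegularMap φ.symm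

theorem eval_smul_of_isHomogeneous {f : MvPolynomial ι k} {d : ℕ} (hf : f.IsHomogeneous d)
    (a : k) (v : ι → k) :
    MvPolynomial.eval (a • v) f = a ^ d * MvPolynomial.eval v f := by
  rw [MvPolynomial.eval_eq, MvPolynomial.eval_eq, Finset.mul_sum]
  refine Finset.sum_congr rfl fun m hm => ?_
  have hd : ∑ i ∈ m.support, m i = d := by
    have h := hf (MvPolynomial.mem_support_iff.mp hm)
    simpa [Finsupp.weight_apply, Finsupp.sum] using h
  simp only [Pi.smul_apply, smul_eq_mul, mul_pow, Finset.prod_mul_distrib,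
    Finset.prod_pow_eq_pow_sum, hd]
  ring

theorem isRegularMap_id (U : Set (ℙ k (ι → k))) : IsRegularMap (id : U → U) := by
  have key : ∀ q : ℙ k (ι → k), values (fun i => MvPolynomial.X i) q = q.rep := fun q => by
    funext i
    simp [values]
  refine fun p => ⟨1, fun i => MvPolynomial.X i, fun i => MvPolynomial.isHomogeneous_X k i, ?_, ?_⟩
  · rw [key]
    exact p.1.rep_nonzero
  · intro q hq
    simp only [key, Projectivization.mk_rep, id]

theorem IsRegularMap.comp {U : Set (ℙ k (ι → k))} {V : Set (ℙ k (κ → k))}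
    {W : Set (ℙ k (τ → k))} {ψ : V → W} {φ : U → V}
    (hψ : IsRegularMap ψ) (hφ : IsRegularMap φ) : IsRegularMap (ψ ∘ φ) := by
  intro p
  obtain ⟨d, f, hf, hfp, hfq⟩ := hφ p
  obtain ⟨e, h, hh, hhp, hhq⟩ := hψ (φ p)
  obtain ⟨j, hj⟩ := Function.ne_iff.mp hfp
  -- the scaling between chosen coordinates of the image and the values of the forms
  have scale : ∀ q : U, values f q ≠ 0 → ∃ a : kˣ, ∀ l,
      values h (φ q) l = (a : k) ^ e * MvPolynomial.eval (values f q) (h l) := by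
    intro q hq
    obtain ⟨a, ha⟩ := Projectivization.exists_smul_eq_mk_rep k (values f q) hq
    refine ⟨a, fun l => ?_⟩
    rw [← eval_smul_of_isHomogeneous (hh l), values, hfq q hq, ← ha]
    rfl
  have val : ∀ (q : U) l, values (fun l => f j * MvPolynomial.aeval f (h l)) q l =
      values f q j * MvPolynomial.eval (values f q) (h l) := by
    intro q l
    have h1 : MvPolynomial.eval q.1.rep (MvPolynomial.aeval f (h l)) =
        MvPolynomial.eval (values f q) (h l) := by
      rw [MvPolynomial.aeval_eq_bind₁]
      exact MvPolynomial.eval₂Hom_bind₁ (RingHom.id k) q.1.rep f (h l)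
    simp only [values, map_mul]
    rw [h1]
  refine ⟨d + d * e, fun l => f j * MvPolynomial.aeval f (h l),
    fun l => (hf j).mul ((hh l).aeval f hf), ?_, ?_⟩
  · obtain ⟨l, hl⟩ := Function.ne_iff.mp hhp
    obtain ⟨a, ha⟩ := scale p hfp
    refine Function.ne_iff.mpr ⟨l, ?_⟩
    rw [val]
    rw [ha] at hl
    exact mul_ne_zero hj (right_ne_zero_of_mul hl)
  · intro q hq
    have hfq0 : values f q ≠ 0 := by
      rintro h0
      refine hq (funext fun l => ?_)
      rw [val, h0]
      simp
    obtain ⟨a, ha⟩ := scale q hfq0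
    have hj0 : values f q j ≠ 0 := by
      intro h0
      refine hq (funext fun l => ?_)
      rw [val, h0]
      simp
    have hh0 : values h (φ q) ≠ 0 := by
      intro h0
      refine hq (funext fun l => ?_)
      have := congrFun h0 l
      rw [ha] at this
      rw [val]
      simp only [Pi.zero_apply, mul_eq_zero, pow_eq_zero_iff', Units.ne_zero, false_and,
        false_or] at this
      simp [this]
    rw [Function.comp, hhq (φ q) hh0, Projectivization.mk_eq_mk_iff']
    refine ⟨(a : k) ^ e / values f q j, funext fun l => ?_⟩
    rw [Pi.smul_apply, smul_eq_mul, val, ha]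
    field_simp

/-- The automorphism group `Aut(X)` of the variety `X`: all biregular self-bijections (they are
not required to extend to the ambient projective space). -/
def VarAut (X : Set (ℙ k (ι → k))) : Subgroup (Equiv.Perm X) where
  carrier := {e | IsBiregular e}
  one_mem' := ⟨isRegularMap_id X, isRegularMap_id X⟩
  mul_mem' := fun ha hb => ⟨ha.1.comp hb.1, hb.2.comp ha.2⟩
  inv_mem' := fun ha => ⟨ha.2, ha.1⟩

/-! ### Equivariant birational geometry -/

/-- `X` and `Y`, with regular actions of `G` given by `a` and `b`, are `G`-equivariantly
birational: there is an isomorphism between dense open subsets of `X` and `Y` which, as a rational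
map, commutes with the actions. -/
def EquivariantlyBirational {G : Type*} [Group G]
    {X : Set (ℙ k (ι → k))} {Y : Set (ℙ k (κ → k))} (a : G →* VarAut X) (b : G →* VarAut Y) :
    Prop :=
  ∃ (U : Set (ℙ k (ι → k))) (V : Set (ℙ k (κ → k))) (hU : U ⊆ X) (hV : V ⊆ Y),
    IsDenseOpen X U ∧ IsDenseOpen Y V ∧ ∃ φ : U ≃ V, IsBiregular φ ∧
      ∀ (g : G) (x : U) (hx : ((a g).1 ⟨x, hU x.2⟩ : ℙ k (ι → k)) ∈ U),
        (φ ⟨_, hx⟩ : ℙ k (κ → k)) = (b g).1 ⟨φ x, hV (φ x).2⟩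

/-- The action `b` on the projective space `ℙ(V)`, `V = k^ι`, is the projectivization of the linear
representation `ρ` on `V`. (It need not be faithful or generically free.) -/
def IsProjectivization {G : Type*} [Group G]
    (b : G →* VarAut (Set.univ : Set (ℙ k (ι → k))))
    (ρ : G →* LinearMap.GeneralLinearGroup k (ι → k)) : Prop :=
  ∀ (g : G) (p : (Set.univ : Set (ℙ k (ι → k)))), ((b g).1 p : ℙ k (ι → k)) = ρ g • p.1

/-- A regular action of `G` on an `n`-dimensional variety `X` is linearizable if it is
equivariantly birational to the projectivization `ℙⁿ = ℙ(V)` of a linear representation `V` of `G`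
of dimension `n + 1`. -/
def IsLinearizable (n : ℕ) {G : Type*} [Group G] {X : Set (ℙ k (ι → k))} (a : G →* VarAut X) :
    Prop :=
  ∃ (ρ : G →* LinearMap.GeneralLinearGroup k (Fin (n + 1) → k))
    (b : G →* VarAut (Set.univ : Set (ℙ k (Fin (n + 1) → k)))),
    IsProjectivization b ρ ∧ EquivariantlyBirational a b

/-- The action is generically free: all points of a dense open subset have trivial stabilizer. -/
def IsGenericallyFree {G : Type*} [Group G] {X : Set (ℙ k (ι → k))} (a : G →* VarAut X) : Prop :=
  ∃ U, IsDenseOpen X U ∧ ∀ x : X, x.1 ∈ U → ∀ g : G, (a g).1 x = x → g = 1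

/-! ### Products of projective spaces, as varieties via the Segre embedding -/

/-- The image of `([y], [z])` under the Segre embedding, with coordinates `y i * z j`. -/
noncomputable def segrePoint (p : ℙ k (ι → k)) (q : ℙ k (κ → k)) : ℙ k (ι × κ → k) :=
  Projectivization.mk k (fun ij => p.rep ij.1 * q.rep ij.2) (by
    obtain ⟨i, hi⟩ := Function.ne_iff.mp p.rep_nonzero
    obtain ⟨j, hj⟩ := Function.ne_iff.mp q.rep_nonzero
    exact Function.ne_iff.mpr ⟨(i, j), mul_ne_zero hi hj⟩)

/-- The Segre variety, that is, the product `ℙ(k^ι) × ℙ(k^κ)` as a projective variety. -/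
def segre (k : Type*) [Field k] (ι κ : Type*) : Set (ℙ k (ι × κ → k)) :=
  Set.range fun pq : ℙ k (ι → k) × ℙ k (κ → k) => segrePoint pq.1 pq.2

/-- The action `b` on `ℙ(V) × ℙ(W)` is `g ([y], [z]) = ([ρ(g) y], [σ(g) z])`, for linear
representations `ρ` on `V = k^ι` and `σ` on `W = k^κ`. Thus it lifts to the linear action
`g (y, [z]) = (ρ(g) y, [σ(g) z])` on the trivial vector bundle `V × ℙ(W)` over `ℙ(W)`, whose
projectivization is `ℙ(V) × ℙ(W)`. -/
def IsProductProjectivization {G : Type*} [Group G] (b : G →* VarAut (segre k ι κ))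
    (ρ : G →* LinearMap.GeneralLinearGroup k (ι → k))
    (σ : G →* LinearMap.GeneralLinearGroup k (κ → k)) : Prop :=
  ∀ (g : G) (p : ℙ k (ι → k)) (q : ℙ k (κ → k)),
    ((b g).1 ⟨segrePoint p q, ⟨(p, q), rfl⟩⟩ : ℙ k (ι × κ → k)) = segrePoint (ρ g • p) (σ g • q)

/-! ### Cubic threefolds -/

/-- `f` is an equation of a cubic threefold in `ℙ⁴`: an irreducible form of degree 3. -/
def IsCubicThreefold (f : MvPolynomial (Fin 5) k) : Prop :=
  f.IsHomogeneous 3 ∧ Irreducible f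

/-- The singular locus of the hypersurface with (squarefree) equation `f`: its points where all
partial derivatives of `f` vanish. -/
def singularLocus (f : MvPolynomial ι k) : Set (ℙ k (ι → k)) :=
  {p | p ∈ hypersurface f ∧ ∀ i, MvPolynomial.eval p.rep (MvPolynomial.pderiv i f) = 0}

/-- `S` contains a plane, the projectivization of a 3-dimensional linear subspace. -/
def ContainsPlane (S : Set (ℙ k (ι → k))) : Prop :=
  ∃ W : Submodule k (ι → k), Module.finrank k W = 3 ∧
    ∀ p : ℙ k (ι → k), p.submodule ≤ W → p ∈ S

/-- `X` is a cone: for some point `v` (a vertex), `X` contains, together with each of its points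
`p`, the whole line through `v` and `p`. -/
def IsCone (X : Set (ℙ k (ι → k))) : Prop :=
  ∃ v : ℙ k (ι → k), ∀ p ∈ X, ∀ q : ℙ k (ι → k), q.submodule ≤ v.submodule ⊔ p.submodule → q ∈ X

/-- The automorphism group of the hypersurface with equation `f` fixes a singular point. -/
def FixesSingularPoint (f : MvPolynomial (Fin 5) k) : Prop :=
  ∃ p : hypersurface f, p.1 ∈ singularLocus f ∧ ∀ g ∈ VarAut (hypersurface f), g p = p

/-- The form `x₁x₄² + x₂x₄x₅ + x₃x₅²` (coordinates are indexed from `0`). -/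
noncomputable def planeCubic (k : Type*) [Field k] : MvPolynomial (Fin 5) k :=
  MvPolynomial.X 0 * MvPolynomial.X 3 ^ 2 + MvPolynomial.X 1 * MvPolynomial.X 3 * MvPolynomial.X 4
    + MvPolynomial.X 2 * MvPolynomial.X 4 ^ 2

/-- The cubic threefold `x₁x₄² + x₂x₄x₅ + x₃x₅² = 0` in `ℙ⁴`. -/
def planeCubicThreefold (k : Type*) [Field k] : Set (ℙ k (Fin 5 → k)) :=
  hypersurface (planeCubic k)

end ClassicalVariety

open ClassicalVariety

/-! The key is the map `scroll` from ℙ¹ × ℙ² to X₀, a linear projection of the Segre threefold. It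
is the normalization of X₀: injective where z₂ ≠ 0, while on z₂ = 0 it is multiplication of two
binary linear forms and so identifies (y, z) with (z, y) over the singular plane.

Part (1): a cubic singular along the plane x₃ = x₄ = 0 lies in the square of the ideal (x₃, x₄), so
it equals L₀x₃² + L₁x₃x₄ + L₂x₄² with linear forms Lᵢ. It is therefore the pullback of `planeCubic`
by a linear endomorphism (`exists_eval_eq_eval_planeCubic`). A kernel vector would be the vertex of
a cone, so the endomorphism is invertible.

Automorphisms: composed with `scroll`, an automorphism of X₀ is given by bihomogeneous polynomials
without common factor (`exists_forms_of_isRegularMap`), and the cubic equation with unique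
factorization lifts it to a self-map of ℙ¹ × ℙ² (`exists_lift_of_isRegularMap`). Comparing bidegrees
with those of the inverse shows that the lift is a pair (A, B) of linear maps
(`exists_linear_lift`). Compatibility with the gluing over the singular plane forces B to preserve
z₂ = 0 and A to be projectively the restriction of B to it. Scaling B so that it fixes the
coordinate z₂ makes it unique, which gives honest representations σ = B and ρ = its 2 × 2 block
(`exists_representations`).

Part (3): `scroll` is birational and intertwines the actions. Since σ is faithful and fixes z₂, an
element fixing a point of ℙ² with z₂ ≠ 0 fixes the vector itself, so a finite group acts generically
freely.

Part (2) is a form of the no-name lemma. For finite G, averaging over a free orbit gives two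
equivariant maps e₀, e₁ from the plane to the representation ρ that are generically independent
(`exists_equivariant_frame`). Writing y = t e₀(w) + w₂ e₁(w), z = w identifies X₀ birationally with
ℙ(1 ⊕ σ) = ℙ³, equivariantly because w₂ is invariant. -/

namespace ClassicalVariety

/-! ### Maps given by forms: regularity, density, birationality -/

section Forms

variable {k : Type*} [Field k] {ι κ τ : Type*}

theorem exists_rep_mk_eq_smul (v : ι → k) (hv : v ≠ 0) :
    ∃ a : k, a ≠ 0 ∧ (Projectivization.mk k v hv).rep = a • v := by
  obtain ⟨a, ha⟩ := Projectivization.exists_smul_eq_mk_rep k v hv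
  exact ⟨a, a.ne_zero, ha.symm⟩

theorem eval_rep_mk_eq_zero_iff {f : MvPolynomial ι k} {d : ℕ} (hf : f.IsHomogeneous d)
    (v : ι → k) (hv : v ≠ 0) :
    MvPolynomial.eval (Projectivization.mk k v hv).rep f = 0 ↔ MvPolynomial.eval v f = 0 := by
  obtain ⟨a, ha, h⟩ := exists_rep_mk_eq_smul v hv
  rw [h, eval_smul_of_isHomogeneous hf]
  simp [ha]

theorem mk_mem_hypersurface {f : MvPolynomial ι k} {d : ℕ} (hf : f.IsHomogeneous d)
    (v : ι → k) (hv : v ≠ 0) :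
    Projectivization.mk k v hv ∈ hypersurface f ↔ MvPolynomial.eval v f = 0 :=
  eval_rep_mk_eq_zero_iff hf v hv

theorem values_mk {f : κ → MvPolynomial ι k} {d : ℕ} (hf : ∀ j, (f j).IsHomogeneous d)
    (v : ι → k) (hv : v ≠ 0) :
    ∃ a : k, a ≠ 0 ∧
      values f (Projectivization.mk k v hv) = a • fun j => MvPolynomial.eval v (f j) := by
  obtain ⟨a, ha, h⟩ := exists_rep_mk_eq_smul v hv
  refine ⟨a ^ d, pow_ne_zero _ ha, funext fun j => ?_⟩
  rw [values, h, eval_smul_of_isHomogeneous (hf j)]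
  rfl

theorem isRegularMap_of_forms {U : Set (ℙ k (ι → k))} {V : Set (ℙ k (κ → k))} (φ : U → V)
    (d : ℕ) (f : κ → MvPolynomial ι k) (hf : ∀ j, (f j).IsHomogeneous d)
    (h : ∀ (v : ι → k) (hv : v ≠ 0) (hU : Projectivization.mk k v hv ∈ U),
      ∃ h0 : (fun j => MvPolynomial.eval v (f j)) ≠ 0,
        (φ ⟨_, hU⟩ : ℙ k (κ → k)) = Projectivization.mk k _ h0) :
    IsRegularMap φ := by
  intro p
  refine ⟨d, f, hf, ?_, fun q hq => ?_⟩
  · exact (h p.1.rep p.1.rep_nonzero (by rw [Projectivization.mk_rep]; exact p.2)).1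
  · obtain ⟨h0, h1⟩ := h q.1.rep q.1.rep_nonzero (by rw [Projectivization.mk_rep]; exact q.2)
    simp only [Projectivization.mk_rep] at h1
    exact h1

theorem eval_aeval (N : κ → MvPolynomial ι k) (f : MvPolynomial κ k) (w : ι → k) :
    MvPolynomial.eval w (MvPolynomial.aeval N f) =
      MvPolynomial.eval (fun j => MvPolynomial.eval w (N j)) f := by
  rw [MvPolynomial.aeval_eq_bind₁]
  exact MvPolynomial.eval₂Hom_bind₁ (RingHom.id k) w N f

/-- The complement of a hypersurface in a variety parametrized by polynomials is dense, if it is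
not empty. -/
theorem isDenseOpen_of_parametrization [Infinite k] {X : Set (ℙ k (ι → k))}
    (h : MvPolynomial ι k) {e : ℕ} (hh : h.IsHomogeneous e) (N : ι → MvPolynomial τ k)
    (hN : ∀ v (hv : v ≠ 0), Projectivization.mk k v hv ∈ X ↔
      ∃ w, v = fun i => MvPolynomial.eval w (N i))
    (w₀ : τ → k) (hw₀ : (fun i => MvPolynomial.eval w₀ (N i)) ≠ 0)
    (hw₁ : MvPolynomial.eval (fun i => MvPolynomial.eval w₀ (N i)) h ≠ 0) :
    IsDenseOpen X (X \ hypersurface h) := by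
  refine ⟨⟨hypersurface h, ⟨{h}, ?_, ?_⟩, rfl⟩, ?_⟩
  · rintro _ rfl
    exact ⟨e, hh⟩
  · simp
  · rintro Z ⟨S, hS, rfl⟩ hZ p hp
    simp only [Set.mem_iInter]
    intro f hf
    obtain ⟨d, hd⟩ := hS f hf
    obtain ⟨j, hj⟩ := Function.ne_iff.mp hw₀
    -- Pulled back to the parameters, density becomes cancellation in a polynomial ring. The factor
    -- `N j` discards parameters with zero image, which represent no point.
    have key : MvPolynomial.aeval N f * (MvPolynomial.aeval N h * N j) = 0 := by
      apply MvPolynomial.funext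
      intro w
      simp only [map_mul, eval_aeval, map_zero]
      by_contra hne
      have h1 := left_ne_zero_of_mul hne
      have h2 := left_ne_zero_of_mul (right_ne_zero_of_mul hne)
      have h3 := right_ne_zero_of_mul (right_ne_zero_of_mul hne)
      have hw : (fun i => MvPolynomial.eval w (N i)) ≠ 0 := fun h0 => h3 (congrFun h0 j)
      have := hZ (a := Projectivization.mk k _ hw) ⟨(hN _ hw).2 ⟨w, rfl⟩, fun h4 =>
        h2 ((mk_mem_hypersurface hh _ hw).1 h4)⟩
      simp only [Set.mem_iInter] at this
      exact h1 ((mk_mem_hypersurface hd _ hw).1 (this f hf))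
    have hne : MvPolynomial.aeval N h * N j ≠ 0 := by
      intro h0
      have := congrArg (MvPolynomial.eval w₀) h0
      simp only [map_mul, eval_aeval, map_zero] at this
      exact (mul_ne_zero hw₁ hj) this
    have hf0 := (mul_eq_zero.mp key).resolve_right hne
    have hrep : p = Projectivization.mk k p.rep p.rep_nonzero := p.mk_rep.symm
    obtain ⟨w, hw⟩ := (hN p.rep p.rep_nonzero).1 (by rw [← hrep]; exact hp)
    have := congrArg (MvPolynomial.eval w) hf0
    rw [eval_aeval, ← hw, map_zero] at this
    exact this


theorem mk_eval_forms_congr {f : κ → MvPolynomial ι k} {d : ℕ} (hf : ∀ j, (f j).IsHomogeneous d)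
    {v w : ι → k} (hv : v ≠ 0) (hw : w ≠ 0)
    (hvw : Projectivization.mk k v hv = Projectivization.mk k w hw)
    (h : (fun j => MvPolynomial.eval v (f j)) ≠ 0) (h' : (fun j => MvPolynomial.eval w (f j)) ≠ 0) :
    Projectivization.mk k _ h = Projectivization.mk k _ h' := by
  rw [Projectivization.mk_eq_mk_iff'] at hvw ⊢
  obtain ⟨a, rfl⟩ := hvw
  refine ⟨a ^ d, funext fun j => ?_⟩
  rw [eval_smul_of_isHomogeneous (hf j)]
  rfl

/-- Mutually inverse rational maps given by forms define a birational map. -/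
theorem equivariantlyBirational_of_forms {G : Type*} [Group G]
    {X : Set (ℙ k (ι → k))} {Y : Set (ℙ k (κ → k))} (a : G →* VarAut X) (b : G →* VarAut Y)
    (h : MvPolynomial ι k) {m : ℕ} (hh : h.IsHomogeneous m)
    (F : κ → MvPolynomial ι k) (H : ι → MvPolynomial κ k) {d e : ℕ}
    (hF : ∀ j, (F j).IsHomogeneous d) (hH : ∀ i, (H i).IsHomogeneous e)
    (denseX : IsDenseOpen X (X \ hypersurface h))
    (denseY : IsDenseOpen Y (Y \ hypersurface (MvPolynomial.aeval H h)))
    (mapF : ∀ v (hv : v ≠ 0), Projectivization.mk k v hv ∈ X → MvPolynomial.eval v h ≠ 0 →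
      ∃ h0 : (fun j => MvPolynomial.eval v (F j)) ≠ 0, Projectivization.mk k _ h0 ∈ Y ∧
        ∃ c : k, c ≠ 0 ∧
          (fun i => MvPolynomial.eval (fun j => MvPolynomial.eval v (F j)) (H i)) = c • v)
    (mapH : ∀ w (hw : w ≠ 0), Projectivization.mk k w hw ∈ Y →
      MvPolynomial.eval (fun i => MvPolynomial.eval w (H i)) h ≠ 0 →
      ∃ h0 : (fun i => MvPolynomial.eval w (H i)) ≠ 0, Projectivization.mk k _ h0 ∈ X ∧
        ∃ c : k, (fun j => MvPolynomial.eval (fun i => MvPolynomial.eval w (H i)) (F j)) = c • w)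
    (T : G → LinearMap.GeneralLinearGroup k (κ → k))
    (hT : ∀ g p, ((b g).1 p : ℙ k (κ → k)) = T g • p.1)
    (equiv : ∀ g (w : κ → k) (hw : w ≠ 0), Projectivization.mk k w hw ∈ Y →
      MvPolynomial.eval (fun i => MvPolynomial.eval w (H i)) h ≠ 0 →
      ∀ (h0 : (fun i => MvPolynomial.eval w (H i)) ≠ 0) (hX : Projectivization.mk k _ h0 ∈ X),
      ∃ h1 : (fun i => MvPolynomial.eval (T g • w) (H i)) ≠ 0,
      ((a g).1 ⟨_, hX⟩ : ℙ k (ι → k)) = Projectivization.mk k _ h1) :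
    EquivariantlyBirational a b := by
  have hh' : (MvPolynomial.aeval H h).IsHomogeneous (e * m) := hh.aeval H hH
  have F_mem : ∀ (v : ι → k) (hv : v ≠ 0), Projectivization.mk k v hv ∈ X \ hypersurface h →
      ∃ h0 : (fun j => MvPolynomial.eval v (F j)) ≠ 0, Projectivization.mk k _ h0 ∈
        Y \ hypersurface (MvPolynomial.aeval H h) := by
    rintro v hv ⟨hvX, hvh⟩
    rw [mk_mem_hypersurface hh] at hvh
    obtain ⟨h0, hY, c, hc, hcv⟩ := mapF v hv hvX hvh
    refine ⟨h0, hY, ?_⟩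
    rw [mk_mem_hypersurface hh', eval_aeval, hcv, eval_smul_of_isHomogeneous hh]
    exact mul_ne_zero (pow_ne_zero _ hc) hvh
  have H_mem : ∀ (w : κ → k) (hw : w ≠ 0), Projectivization.mk k w hw ∈
        Y \ hypersurface (MvPolynomial.aeval H h) →
      ∃ h0 : (fun i => MvPolynomial.eval w (H i)) ≠ 0, Projectivization.mk k _ h0 ∈
        X \ hypersurface h := by
    rintro w hw ⟨hwY, hwh⟩
    rw [mk_mem_hypersurface hh', eval_aeval] at hwh
    obtain ⟨h0, hX, -⟩ := mapH w hw hwY hwh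
    exact ⟨h0, hX, fun h1 => hwh ((mk_mem_hypersurface hh _ h0).1 h1)⟩
  let φ : (X \ hypersurface h : Set _) → (Y \ hypersurface (MvPolynomial.aeval H h) : Set _) :=
    fun x => ⟨_, (F_mem x.1.rep x.1.rep_nonzero
      (by rw [Projectivization.mk_rep]; exact x.2)).2⟩
  let ψ : (Y \ hypersurface (MvPolynomial.aeval H h) : Set _) → (X \ hypersurface h : Set _) :=
    fun x => ⟨_, (H_mem x.1.rep x.1.rep_nonzero
      (by rw [Projectivization.mk_rep]; exact x.2)).2⟩
  have φ_mk : ∀ (v : ι → k) (hv : v ≠ 0) (hU : Projectivization.mk k v hv ∈ X \ hypersurface h),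
      ∃ h0 : (fun j => MvPolynomial.eval v (F j)) ≠ 0,
        (φ ⟨_, hU⟩ : ℙ k (κ → k)) = Projectivization.mk k _ h0 := by
    intro v hv hU
    refine ⟨(F_mem v hv hU).1, ?_⟩
    exact mk_eval_forms_congr hF (Projectivization.rep_nonzero _) hv
      (Projectivization.mk_rep _) _ _
  have ψ_mk : ∀ (w : κ → k) (hw : w ≠ 0)
      (hV : Projectivization.mk k w hw ∈ Y \ hypersurface (MvPolynomial.aeval H h)),
      ∃ h0 : (fun i => MvPolynomial.eval w (H i)) ≠ 0,
        (ψ ⟨_, hV⟩ : ℙ k (ι → k)) = Projectivization.mk k _ h0 := by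
    intro w hw hV
    refine ⟨(H_mem w hw hV).1, ?_⟩
    exact mk_eval_forms_congr hH (Projectivization.rep_nonzero _) hw
      (Projectivization.mk_rep _) _ _
  have left : Function.LeftInverse ψ φ := by
    rintro ⟨p, hp⟩
    induction p using Projectivization.ind with
    | h v hv =>
      obtain ⟨h0, h1⟩ := φ_mk v hv hp
      have hmem := (F_mem v hv hp).2
      have h2 : φ ⟨_, hp⟩ = ⟨_, hmem⟩ := Subtype.ext h1
      obtain ⟨h3, h4⟩ := ψ_mk _ h0 hmem
      rw [h2]
      refine Subtype.ext (h4.trans ?_)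
      rw [Projectivization.mk_eq_mk_iff']
      obtain ⟨-, -, c, -, hcv⟩ := mapF v hv hp.1 (fun h5 => hp.2 ((mk_mem_hypersurface hh _ hv).2 h5))
      exact ⟨c, hcv.symm⟩
  have right : Function.RightInverse ψ φ := by
    rintro ⟨p, hp⟩
    induction p using Projectivization.ind with
    | h w hw =>
      obtain ⟨h0, h1⟩ := ψ_mk w hw hp
      have hmem := (H_mem w hw hp).2
      have h2 : ψ ⟨_, hp⟩ = ⟨_, hmem⟩ := Subtype.ext h1
      obtain ⟨h3, h4⟩ := φ_mk _ h0 hmem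
      rw [h2]
      refine Subtype.ext (h4.trans ?_)
      rw [Projectivization.mk_eq_mk_iff']
      have h5 := fun h5 => hp.2 ((mk_mem_hypersurface hh' _ hw).2 h5)
      rw [eval_aeval] at h5
      obtain ⟨-, -, c, hcv⟩ := mapH w hw hp.1 h5
      exact ⟨c, hcv.symm⟩
  refine ⟨_, _, Set.sdiff_subset, Set.sdiff_subset, denseX, denseY, ⟨φ, ψ, left, right⟩,
    ⟨isRegularMap_of_forms φ d F hF φ_mk, isRegularMap_of_forms ψ e H hH ψ_mk⟩, ?_⟩
  intro g x hx
  -- Every point of the source is in the image of `ψ`, so equivariance of `φ` follows from that of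
  -- its inverse, which is what `equiv` supplies.
  obtain ⟨y, rfl⟩ := left.surjective x
  obtain ⟨p, hp⟩ := y
  induction p using Projectivization.ind with
  | h w hw =>
    obtain ⟨h0, h1⟩ := ψ_mk w hw hp
    have h5 := fun h5 => hp.2 ((mk_mem_hypersurface hh' _ hw).2 h5)
    rw [eval_aeval] at h5
    have hmem := (H_mem w hw hp).2
    obtain ⟨h6, h7⟩ := equiv g w hw hp.1 h5 h0 hmem.1
    have h8 : (⟨ψ ⟨_, hp⟩, Set.sdiff_subset (ψ ⟨_, hp⟩).2⟩ : X) = ⟨_, hmem.1⟩ := Subtype.ext h1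
    change (φ ⟨_, hx⟩ : ℙ k (κ → k)) = (b g).1 ⟨φ (ψ ⟨_, hp⟩), _⟩
    have h9 := right ⟨_, hp⟩
    rw [hT]
    simp only [h9]
    rw [Projectivization.smul_mk]
    have hx' := hx
    simp only [h8, h7] at hx'
    obtain ⟨h10, h11⟩ := φ_mk _ h6 hx'
    have h12 : (⟨((a g).1 ⟨ψ ⟨_, hp⟩, Set.sdiff_subset (ψ ⟨_, hp⟩).2⟩ : ℙ k (ι → k)), hx⟩ :
      (X \ hypersurface h : Set _)) = ⟨_, hx'⟩ := Subtype.ext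
        ((congrArg (fun t : X => ((a g).1 t : ℙ k (ι → k))) h8).trans h7)
    rw [h12, h11, Projectivization.mk_eq_mk_iff']
    have hY : Projectivization.mk k (T g • w) ((smul_ne_zero_iff_ne (T g)).mpr hw) ∈ Y := by
      have := ((b g).1 ⟨_, hp.1⟩).2
      rw [hT] at this
      exact this
    obtain ⟨-, -, c, hc⟩ := mapH (T g • w) ((smul_ne_zero_iff_ne (T g)).mpr hw) hY
      (fun h13 => hx'.2 ((mk_mem_hypersurface hh _ h6).2 h13))
    exact ⟨c, hc.symm⟩

end Forms

/-! ### Linear maps and linear actions -/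

section Linear

variable {k : Type*} [Field k] {ι κ τ : Type*} [Fintype ι] [DecidableEq ι]

/-- The linear forms that are the coordinates of a linear map. -/
noncomputable def linearForms (A : (ι → k) →ₗ[k] (κ → k)) (j : κ) : MvPolynomial ι k :=
  ∑ i, MvPolynomial.C (A (Pi.single i 1) j) * MvPolynomial.X i

theorem eval_linearForms (A : (ι → k) →ₗ[k] (κ → k)) (v : ι → k) (j : κ) :
    MvPolynomial.eval v (linearForms A j) = A v j := by
  have hv : v = ∑ i, v i • (Pi.single i 1 : ι → k) := by
    funext i
    simp [Finset.sum_apply, Pi.single_apply]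
  conv_rhs => rw [hv]
  simp [linearForms, mul_comm]

theorem isHomogeneous_linearForms (A : (ι → k) →ₗ[k] (κ → k)) (j : κ) :
    (linearForms A j).IsHomogeneous 1 :=
  MvPolynomial.IsHomogeneous.sum _ _ _ fun _ _ => MvPolynomial.isHomogeneous_C_mul_X _ _

theorem generalLinearGroup_smul_apply {V : Type*} [AddCommGroup V] [Module k V]
    (A : LinearMap.GeneralLinearGroup k V) (v : V) : A • v = (A : V →ₗ[k] V) v := rfl

theorem isRegularMap_of_linear {U V : Set (ℙ k (ι → k))} (φ : U → V)
    (A : LinearMap.GeneralLinearGroup k (ι → k)) (h : ∀ p, (φ p : ℙ k (ι → k)) = A • p.1) :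
    IsRegularMap φ := by
  refine isRegularMap_of_forms φ 1 (linearForms (A : (ι → k) →ₗ[k] (ι → k)))
    (isHomogeneous_linearForms _) fun v hv hU => ?_
  have key : (fun j => MvPolynomial.eval v
      (linearForms (A : (ι → k) →ₗ[k] (ι → k)) j)) = A • v := by
    funext j
    rw [eval_linearForms, generalLinearGroup_smul_apply]
  refine ⟨by rw [key]; exact (smul_ne_zero_iff_ne A).mpr hv, ?_⟩
  rw [h]
  simp only [key, Projectivization.smul_mk]

/-- A linear representation of a group that preserves `X` acts on `X` by automorphisms. -/
noncomputable def linearAction {G : Type*} [Group G]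
    (T : G →* LinearMap.GeneralLinearGroup k (ι → k)) (X : Set (ℙ k (ι → k)))
    (hX : ∀ g, ∀ p ∈ X, T g • p ∈ X) : G →* VarAut X where
  toFun g := ⟨⟨fun p => ⟨T g • p.1, hX g _ p.2⟩, fun p => ⟨T g⁻¹ • p.1, hX _ _ p.2⟩,
    fun p => Subtype.ext (by simp), fun p => Subtype.ext (by simp)⟩,
    ⟨isRegularMap_of_linear _ (T g) fun _ => rfl, isRegularMap_of_linear _ (T g⁻¹) fun _ => rfl⟩⟩
  map_one' := Subtype.ext (Equiv.ext fun p => Subtype.ext (by simp))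
  map_mul' g h := Subtype.ext (Equiv.ext fun p => Subtype.ext (by simp [mul_smul]))

theorem linearAction_apply {G : Type*} [Group G]
    (T : G →* LinearMap.GeneralLinearGroup k (ι → k)) (X : Set (ℙ k (ι → k)))
    (hX : ∀ g, ∀ p ∈ X, T g • p ∈ X) (g : G) (p : X) :
    ((linearAction T X hX g).1 p : ℙ k (ι → k)) = T g • p.1 := rfl

end Linear
end ClassicalVariety

namespace ClassicalVariety

/-! ### Weighted homogeneity and factorization -/

section Weights

variable {k : Type*} [Field k] {σ : Type*}

/-- `F` is quasi-homogeneous of degree `a` for the weights `w`, as a polynomial function. -/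
def IsQuasiHomogeneous (w : σ → ℕ) (F : MvPolynomial σ k) (a : ℕ) : Prop :=
  ∀ (s : k) (v : σ → k), MvPolynomial.eval (fun i => s ^ w i * v i) F =
    s ^ a * MvPolynomial.eval v F

/-- The substitution `Xᵢ ↦ T ^ wᵢ Xᵢ`. -/
noncomputable def weightSubst (k : Type*) [Field k] (w : σ → ℕ) :
    MvPolynomial σ k →ₐ[k] Polynomial (MvPolynomial σ k) :=
  MvPolynomial.aeval fun i => Polynomial.C (MvPolynomial.X i) * Polynomial.X ^ w i

theorem eval_map_weightSubst (w : σ → ℕ) (F : MvPolynomial σ k) (s : k) (v : σ → k) :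
    Polynomial.eval s ((weightSubst k w F).map (MvPolynomial.eval v)) =
      MvPolynomial.eval (fun i => s ^ w i * v i) F := by
  induction F using MvPolynomial.induction_on with
  | C a => simp [weightSubst, MvPolynomial.algebraMap_eq, Polynomial.algebraMap_eq,
      IsScalarTower.algebraMap_apply k (MvPolynomial σ k) (Polynomial (MvPolynomial σ k))]
  | add p q hp hq => simp [hp, hq]
  | mul_X p i hp =>
    rw [map_mul, Polynomial.map_mul, Polynomial.eval_mul, hp, map_mul]
    simp only [weightSubst, MvPolynomial.aeval_X, Polynomial.map_mul, Polynomial.map_C,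
      MvPolynomial.eval_X, Polynomial.map_pow, Polynomial.map_X,
      Polynomial.eval_mul, Polynomial.eval_C, Polynomial.eval_pow, Polynomial.eval_X]
    rw [mul_comm (s ^ w i)]

theorem eval_one_weightSubst (w : σ → ℕ) (F : MvPolynomial σ k) :
    Polynomial.eval 1 (weightSubst k w F) = F := by
  induction F using MvPolynomial.induction_on with
  | C a => simp [weightSubst, MvPolynomial.algebraMap_eq, Polynomial.algebraMap_eq,
      IsScalarTower.algebraMap_apply k (MvPolynomial σ k) (Polynomial (MvPolynomial σ k))]
  | add p q hp hq => simp [hp, hq]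
  | mul_X p i hp =>
    rw [map_mul, Polynomial.eval_mul, hp]
    simp [weightSubst]

/-- Over an infinite field the condition on all scalars is an identity of polynomials in a new
variable, for which degrees are available. -/
theorem isQuasiHomogeneous_iff [Infinite k] (w : σ → ℕ) (F : MvPolynomial σ k) (a : ℕ) :
    IsQuasiHomogeneous w F a ↔
      weightSubst k w F = Polynomial.C F * Polynomial.X ^ a := by
  constructor
  · intro h
    ext1 n
    refine MvPolynomial.funext fun v => ?_
    have : (weightSubst k w F).map (MvPolynomial.eval v) =
        (Polynomial.C F * Polynomial.X ^ a).map (MvPolynomial.eval v) := by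
      refine Polynomial.funext fun s => ?_
      rw [eval_map_weightSubst, h]
      rw [mul_comm]
      simp
    simpa [Polynomial.coeff_map, apply_ite (MvPolynomial.eval v)] using congrArg (fun p => Polynomial.coeff p n) this
  · intro h s v
    rw [← eval_map_weightSubst, h, mul_comm (s ^ a)]
    simp

theorem IsQuasiHomogeneous.unique [Infinite k] {w : σ → ℕ} {F : MvPolynomial σ k} {a b : ℕ}
    (ha : IsQuasiHomogeneous w F a) (hb : IsQuasiHomogeneous w F b) (hF : F ≠ 0) : a = b := by
  rw [isQuasiHomogeneous_iff] at ha hb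
  have h := ha.symm.trans hb
  have := congrArg Polynomial.natDegree h
  rwa [Polynomial.natDegree_C_mul_X_pow _ _ hF, Polynomial.natDegree_C_mul_X_pow _ _ hF] at this

/-- After the weighted substitution, the highest and the lowest degrees in the new variable are both
additive. They coincide for the product, hence for each factor, and so each factor becomes a
monomial in that variable. -/
theorem IsQuasiHomogeneous.exists_of_mul [Infinite k] {w : σ → ℕ} {P Q : MvPolynomial σ k} {a : ℕ}
    (h : IsQuasiHomogeneous w (P * Q) a) (h0 : P * Q ≠ 0) :
    ∃ b c, b + c = a ∧ IsQuasiHomogeneous w P b ∧ IsQuasiHomogeneous w Q c := by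
  simp only [isQuasiHomogeneous_iff] at h ⊢
  have hP : weightSubst k w P ≠ 0 := fun h1 => h0 (by
    rw [← eval_one_weightSubst w P, h1]; simp)
  have hQ : weightSubst k w Q ≠ 0 := fun h1 => h0 (by
    rw [← eval_one_weightSubst w Q, h1]; simp)
  rw [map_mul] at h
  have h1 := congrArg Polynomial.natDegree h
  have h2 := congrArg Polynomial.natTrailingDegree h
  rw [Polynomial.natDegree_mul hP hQ, Polynomial.natDegree_C_mul_X_pow _ _ h0] at h1
  rw [Polynomial.natTrailingDegree_mul hP hQ, Polynomial.C_mul_X_pow_eq_monomial,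
    Polynomial.natTrailingDegree_monomial h0] at h2
  have h3 := Polynomial.natTrailingDegree_le_natDegree (weightSubst k w P)
  have h4 := Polynomial.natTrailingDegree_le_natDegree (weightSubst k w Q)
  have mono : ∀ F : MvPolynomial σ k,
      (weightSubst k w F).natTrailingDegree = (weightSubst k w F).natDegree →
      weightSubst k w F = Polynomial.C F * Polynomial.X ^ (weightSubst k w F).natDegree := by
    intro F hF
    set n := (weightSubst k w F).natDegree with hn
    have h5 : weightSubst k w F = Polynomial.monomial n ((weightSubst k w F).coeff n) := by
      ext1 m
      rw [Polynomial.coeff_monomial]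
      split_ifs with hm
      · rw [hm]
      · rcases Nat.lt_or_gt_of_ne hm with hm | hm
        · exact Polynomial.coeff_eq_zero_of_natDegree_lt (hn ▸ hm)
        · exact Polynomial.coeff_eq_zero_of_lt_natTrailingDegree (hF ▸ hm)
    -- Setting the new variable to 1 identifies the coefficient of the monomial with `F`.
    have h6 := eval_one_weightSubst w F
    rw [h5] at h6
    simp only [Polynomial.eval_monomial, one_pow, mul_one] at h6
    rw [Polynomial.C_mul_X_pow_eq_monomial]
    rwa [h6] at h5
  exact ⟨_, _, h1, mono P (by omega), mono Q (by omega)⟩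

end Weights

/-! ### Families without common factor -/

section Primitive

variable {R : Type*} [CommRing R] {κ : Type*}

/-- A family of elements of a ring that has no common factors, in the form of Gauss's lemma. -/
def IsPrimitiveFamily (P : κ → R) : Prop :=
  ∀ a b, (∀ j, a ∣ P j * b) → a ∣ b

/-- Division by the gcd; the cofactors have gcd 1, so the gcd of the products `P j * b` is `b` up to
a unit. -/
theorem exists_eq_mul_isPrimitiveFamily [UniqueFactorizationMonoid R] [Fintype κ] (F : κ → R)
    (hF : F ≠ 0) :
    ∃ (h : R) (P : κ → R), h ≠ 0 ∧ (∀ j, F j = h * P j) ∧ IsPrimitiveFamily P := by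
  obtain ⟨_⟩ : Nonempty (NormalizedGCDMonoid R) := inferInstance
  obtain ⟨j₀, hj₀⟩ := Function.ne_iff.mp hF
  obtain ⟨P, hP, h1⟩ := Finset.extract_gcd F (s := Finset.univ) ⟨j₀, Finset.mem_univ _⟩
  refine ⟨Finset.univ.gcd F, P, ?_, fun j => hP j (Finset.mem_univ _), fun a b hab => ?_⟩
  · intro h0
    exact hj₀ (Finset.gcd_eq_zero_iff.mp h0 j₀ (Finset.mem_univ _))
  · have := Finset.dvd_gcd (s := Finset.univ) (f := fun j => P j * b) fun j _ => hab j
    have h2 := this.trans (Finset.gcd_mul_right' Finset.univ P b).dvd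
    rwa [h1, one_mul] at h2

/-- Proportionality makes a nonzero `P i` divide every `P j * F i`, hence `F i` by primitivity. Thus
a primitive family generates all families proportional to it, with coefficients in the ring itself
and not only in its fraction field. -/
theorem IsPrimitiveFamily.exists_eq_mul [IsDomain R] {P : κ → R} (hP : IsPrimitiveFamily P)
    (h0 : P ≠ 0) (F : κ → R) (h : ∀ i j, P i * F j = P j * F i) :
    ∃ c, ∀ j, F j = c * P j := by
  obtain ⟨i, hi⟩ := Function.ne_iff.mp h0
  obtain ⟨c, hc⟩ : P i ∣ F i := hP _ _ fun j => ⟨F j, (h i j).symm⟩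
  refine ⟨c, fun j => mul_left_cancel₀ hi ?_⟩
  rw [h, hc]
  ring

end Primitive

end ClassicalVariety

namespace ClassicalVariety

/-! ### Bihomogeneous polynomials -/

section Bihomogeneous

variable {k : Type*} [Field k]

/-- `F` is bihomogeneous of bidegree `(a, b)` in two groups of variables, as a polynomial
function. -/
def IsBihomogeneous {ι κ : Type*} (F : MvPolynomial (ι ⊕ κ) k) (a b : ℕ) : Prop :=
  ∀ (s t : k) (y : ι → k) (z : κ → k), MvPolynomial.eval (Sum.elim (s • y) (t • z)) F =
    s ^ a * t ^ b * MvPolynomial.eval (Sum.elim y z) F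

variable {ι κ : Type*}

/-- A bigrading is a pair of weights, which transfers uniqueness of degrees and the behaviour of
factors from the weighted case. -/
theorem isBihomogeneous_iff (F : MvPolynomial (ι ⊕ κ) k) (a b : ℕ) :
    IsBihomogeneous F a b ↔ IsQuasiHomogeneous (Sum.elim (fun _ => 1) (fun _ => 0)) F a ∧
      IsQuasiHomogeneous (Sum.elim (fun _ => 0) (fun _ => 1)) F b := by
  have e1 : ∀ (s : k) (y : ι → k) (z : κ → k),
      (fun i => s ^ (Sum.elim (fun _ => 1) (fun _ => 0) i : ℕ) * Sum.elim y z i) =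
        Sum.elim (s • y) z := fun s y z => by
    funext i; rcases i with i | i <;> simp
  have e2 : ∀ (s : k) (y : ι → k) (z : κ → k),
      (fun i => s ^ (Sum.elim (fun _ => 0) (fun _ => 1) i : ℕ) * Sum.elim y z i) =
        Sum.elim y (s • z) := fun s y z => by
    funext i; rcases i with i | i <;> simp
  constructor
  · intro h
    constructor
    · intro s v
      have := h s 1 (v ∘ Sum.inl) (v ∘ Sum.inr)
      rw [one_smul, one_pow, mul_one, Sum.elim_comp_inl_inr, ← e1, Sum.elim_comp_inl_inr] at this
      exact this
    · intro s v
      have := h 1 s (v ∘ Sum.inl) (v ∘ Sum.inr)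
      rw [one_smul, one_pow, one_mul, Sum.elim_comp_inl_inr, ← e2, Sum.elim_comp_inl_inr] at this
      exact this
  · rintro ⟨h1, h2⟩ s t y z
    rw [← e1, h1, ← e2, h2, mul_assoc]

theorem IsBihomogeneous.unique [Infinite k] {F : MvPolynomial (ι ⊕ κ) k} {a b a' b' : ℕ}
    (h : IsBihomogeneous F a b) (h' : IsBihomogeneous F a' b') (hF : F ≠ 0) : a = a' ∧ b = b' := by
  rw [isBihomogeneous_iff] at h h'
  exact ⟨h.1.unique h'.1 hF, h.2.unique h'.2 hF⟩

theorem IsBihomogeneous.exists_of_mul [Infinite k] {P Q : MvPolynomial (ι ⊕ κ) k} {a b : ℕ}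
    (h : IsBihomogeneous (P * Q) a b) (h0 : P * Q ≠ 0) :
    ∃ c d c' d', c + c' = a ∧ d + d' = b ∧ IsBihomogeneous P c d ∧ IsBihomogeneous Q c' d' := by
  rw [isBihomogeneous_iff] at h
  obtain ⟨c, c', hc, h1, h2⟩ := h.1.exists_of_mul h0
  obtain ⟨d, d', hd, h3, h4⟩ := h.2.exists_of_mul h0
  exact ⟨c, d, c', d', hc, hd, (isBihomogeneous_iff _ _ _).2 ⟨h1, h3⟩,
    (isBihomogeneous_iff _ _ _).2 ⟨h2, h4⟩⟩

theorem isBihomogeneous_zero (a b : ℕ) : IsBihomogeneous (0 : MvPolynomial (ι ⊕ κ) k) a b :=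
  fun s t y z => by simp

theorem IsBihomogeneous.right_of_mul [Infinite k] {P Q : MvPolynomial (ι ⊕ κ) k}
    {a b c d c' d' : ℕ} (h : IsBihomogeneous (P * Q) a b) (hP : IsBihomogeneous P c d)
    (h0 : P ≠ 0) (hc : c + c' = a) (hd : d + d' = b) : IsBihomogeneous Q c' d' := by
  by_cases hQ : Q = 0
  · rw [hQ]; exact isBihomogeneous_zero _ _
  obtain ⟨e, f, e', f', rfl, rfl, h1, h2⟩ := h.exists_of_mul (mul_ne_zero h0 hQ)
  obtain ⟨rfl, rfl⟩ := h1.unique hP h0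
  obtain rfl : c' = e' := by omega
  obtain rfl : d' = f' := by omega
  exact h2

/-- A polynomial in two groups of variables that vanishes wherever neither group vanishes is
zero. -/
theorem eq_zero_of_eval_sumElim [Infinite k] [Nonempty ι] [Nonempty κ]
    {F : MvPolynomial (ι ⊕ κ) k}
    (h : ∀ y z, y ≠ 0 → z ≠ 0 → MvPolynomial.eval (Sum.elim y z) F = 0) : F = 0 := by
  obtain ⟨i⟩ := ‹Nonempty ι›
  obtain ⟨j⟩ := ‹Nonempty κ›
  have : F * (MvPolynomial.X (Sum.inl i) * MvPolynomial.X (Sum.inr j)) = 0 := by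
    refine MvPolynomial.funext fun v => ?_
    by_cases hy : v ∘ Sum.inl = 0
    · have : v (Sum.inl i) = 0 := congrFun hy i
      simp [this]
    by_cases hz : v ∘ Sum.inr = 0
    · have : v (Sum.inr j) = 0 := congrFun hz j
      simp [this]
    have := h _ _ hy hz
    rw [Sum.elim_comp_inl_inr] at this
    simp [this]
  exact (mul_eq_zero.mp this).resolve_right
    (mul_ne_zero (MvPolynomial.X_ne_zero _) (MvPolynomial.X_ne_zero _))

end Bihomogeneous

/-! ### The parametrization of the cubic threefold -/

section Scroll

variable {k : Type*} [Field k]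

/-- The parametrization of the threefold `x₁x₄² + x₂x₄x₅ + x₃x₅² = 0` by pairs of vectors. -/
def scroll {R : Type*} [CommRing R] (y : Fin 2 → R) (z : Fin 3 → R) : Fin 5 → R :=
  ![y 0 * z 0, y 0 * z 1 + y 1 * z 0, y 1 * z 1, -(y 1 * z 2), y 0 * z 2]

theorem map_scroll {R S : Type*} [CommRing R] [CommRing S] (f : R →+* S) (y : Fin 2 → R)
    (z : Fin 3 → R) (j : Fin 5) :
    f (scroll y z j) = scroll (fun i => f (y i)) (fun i => f (z i)) j := by
  fin_cases j <;> simp [scroll]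

theorem scroll_smul {R : Type*} [CommRing R] (s t : R) (y : Fin 2 → R) (z : Fin 3 → R) :
    scroll (s • y) (t • z) = (s * t) • scroll y z := by
  funext j
  fin_cases j <;> simp [scroll] <;> ring

theorem scroll_ne_zero {y : Fin 2 → k} {z : Fin 3 → k} (hy : y ≠ 0) (hz : z ≠ 0) :
    scroll y z ≠ 0 := by
  intro h
  have h0 : y 0 * z 0 = 0 := congrFun h 0
  have h1 : y 0 * z 1 + y 1 * z 0 = 0 := congrFun h 1
  have h2 : y 1 * z 1 = 0 := congrFun h 2
  have h3 : -(y 1 * z 2) = 0 := congrFun h 3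
  have h4 : y 0 * z 2 = 0 := congrFun h 4
  by_cases hy0 : y 0 = 0
  · have hy1 : y 1 ≠ 0 := fun hy1 => hy (by funext i; fin_cases i <;> assumption)
    refine hz (by funext i; fin_cases i <;> simp_all)
  · refine hz (by funext i; fin_cases i <;> simp_all)

theorem eval_planeCubic (v : Fin 5 → k) : MvPolynomial.eval v (planeCubic k) =
    v 0 * v 3 ^ 2 + v 1 * v 3 * v 4 + v 2 * v 4 ^ 2 := by
  simp [planeCubic]

theorem isHomogeneous_planeCubic : (planeCubic k).IsHomogeneous 3 := by
  unfold planeCubic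
  refine ((MvPolynomial.IsHomogeneous.mul (m := 1) (n := 2) (MvPolynomial.isHomogeneous_X k _)
    (MvPolynomial.isHomogeneous_X_pow _ _)).add
      (MvPolynomial.IsHomogeneous.mul (m := 2) (n := 1) ?_ (MvPolynomial.isHomogeneous_X k _))).add
    (MvPolynomial.IsHomogeneous.mul (m := 1) (n := 2) (MvPolynomial.isHomogeneous_X k _)
    (MvPolynomial.isHomogeneous_X_pow _ _))
  exact (MvPolynomial.isHomogeneous_X k _).mul (MvPolynomial.isHomogeneous_X k _)

theorem mk_mem_planeCubicThreefold (v : Fin 5 → k) (hv : v ≠ 0) :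
    Projectivization.mk k v hv ∈ planeCubicThreefold k ↔
      v 0 * v 3 ^ 2 + v 1 * v 3 * v 4 + v 2 * v 4 ^ 2 = 0 := by
  rw [planeCubicThreefold, mk_mem_hypersurface isHomogeneous_planeCubic, eval_planeCubic]

theorem scroll_equation {R : Type*} [CommRing R] (y : Fin 2 → R) (z : Fin 3 → R) :
    scroll y z 0 * scroll y z 3 ^ 2 + scroll y z 1 * scroll y z 3 * scroll y z 4 +
      scroll y z 2 * scroll y z 4 ^ 2 = 0 := by
  simp [scroll]
  ring

/-- The point of the cubic threefold with coordinates `scroll y z`. -/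
def scrollPoint (y : Fin 2 → k) (z : Fin 3 → k) (hy : y ≠ 0) (hz : z ≠ 0) :
    planeCubicThreefold k :=
  ⟨Projectivization.mk k _ (scroll_ne_zero hy hz),
    (mk_mem_planeCubicThreefold _ _).2 (scroll_equation y z)⟩

/-- The polynomials that give the parametrization `scroll`. -/
noncomputable def scrollPoly (k : Type*) [Field k] : Fin 5 → MvPolynomial (Fin 2 ⊕ Fin 3) k :=
  scroll (fun i => MvPolynomial.X (Sum.inl i)) (fun j => MvPolynomial.X (Sum.inr j))

theorem eval_scrollPoly (y : Fin 2 → k) (z : Fin 3 → k) :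
    (fun j => MvPolynomial.eval (Sum.elim y z) (scrollPoly k j)) = scroll y z := by
  funext j
  rw [scrollPoly, map_scroll]
  simp

/-- On the singular plane, surjectivity amounts to factoring a binary quadratic form, which needs a
square root of its discriminant. Off the plane, `y` is read off from the last two coordinates and
`z` is then determined. -/
theorem exists_eq_scroll [IsAlgClosed k] [CharZero k] (v : Fin 5 → k)
    (h : v 0 * v 3 ^ 2 + v 1 * v 3 * v 4 + v 2 * v 4 ^ 2 = 0) :
    ∃ y z, v = scroll y z := by
  by_cases h3 : v 3 = 0
  · by_cases h4 : v 4 = 0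
    · by_cases h0 : v 0 = 0
      · refine ⟨![0, 1], ![v 1, v 2, 0], ?_⟩
        funext j
        fin_cases j <;> simp [scroll, *]
      · obtain ⟨t, ht⟩ := exists_quadratic_eq_zero (a := v 0) (b := - v 1) (c := v 2) h0
          (by
            obtain ⟨s, hs⟩ := IsAlgClosed.exists_eq_mul_self (discrim (v 0) (-v 1) (v 2))
            exact ⟨s, hs⟩)
        refine ⟨![1, t], ![v 0, v 1 - t * v 0, 0], ?_⟩
        funext j
        fin_cases j <;> simp [scroll, *]
        linear_combination ht
    · refine ⟨![1, 0], ![v 0, v 1, v 4], ?_⟩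
      have h2 : v 2 = 0 := by simpa [h3, h4] using h
      funext j
      fin_cases j <;> simp [scroll, *]
  · by_cases h4 : v 4 = 0
    · have h0 : v 0 = 0 := by simpa [h3, h4] using h
      refine ⟨![0, 1], ![v 1, v 2, - v 3], ?_⟩
      funext j
      fin_cases j <;> simp [scroll, *]
    · refine ⟨![v 4, - v 3], ![v 0 / v 4, - v 2 / v 3, 1], ?_⟩
      funext j
      fin_cases j <;> simp [scroll] <;> field_simp
      linear_combination h

theorem exists_scrollPoint_eq [IsAlgClosed k] [CharZero k] (x : planeCubicThreefold k) :
    ∃ y z hy hz, x = scrollPoint y z hy hz := by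
  obtain ⟨p, hp⟩ := x
  induction p using Projectivization.ind with
  | h v hv =>
    obtain ⟨y, z, rfl⟩ := exists_eq_scroll v ((mk_mem_planeCubicThreefold v hv).1 hp)
    refine ⟨y, z, ?_, ?_, rfl⟩
    · rintro rfl
      exact hv (by simpa using scroll_smul 0 1 (0 : Fin 2 → k) z)
    · rintro rfl
      exact hv (by simpa using scroll_smul 1 0 y (0 : Fin 3 → k))

/-- A regular map from the cubic threefold is given by bihomogeneous polynomials without common
factors on its parametrization. -/
theorem exists_forms_of_isRegularMap [Infinite k] {κ : Type*} [Fintype κ] {Y : Set (ℙ k (κ → k))}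
    (φ : planeCubicThreefold k → Y) (hφ : IsRegularMap φ) :
    ∃ (P : κ → MvPolynomial (Fin 2 ⊕ Fin 3) k) (a b : ℕ), (∀ j, IsBihomogeneous (P j) a b) ∧
      ∀ y z hy hz, ∃ h0 : (fun j => MvPolynomial.eval (Sum.elim y z) (P j)) ≠ 0,
        (φ (scrollPoint y z hy hz) : ℙ k (κ → k)) = Projectivization.mk k _ h0 := by
  -- Local forms of degree d pull back to polynomials of bidegree (d, d), since `scroll` has
  -- bidegree (1, 1).
  have loc : ∀ (y₀ : Fin 2 → k) (z₀ : Fin 3 → k) (_ : y₀ ≠ 0) (_ : z₀ ≠ 0),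
      ∃ (d : ℕ) (F : κ → MvPolynomial (Fin 2 ⊕ Fin 3) k), (∀ j, IsBihomogeneous (F j) d d) ∧
        (fun j => MvPolynomial.eval (Sum.elim y₀ z₀) (F j)) ≠ 0 ∧
        ∀ y z hy hz, ∀ h0 : (fun j => MvPolynomial.eval (Sum.elim y z) (F j)) ≠ 0,
        (φ (scrollPoint y z hy hz) : ℙ k (κ → k)) = Projectivization.mk k _ h0 := by
    intro y₀ z₀ hy₀ hz₀
    obtain ⟨d, f, hf, hf0, hfφ⟩ := hφ (scrollPoint y₀ z₀ hy₀ hz₀)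
    have ev : ∀ y z, (fun j => MvPolynomial.eval (Sum.elim y z)
        (MvPolynomial.aeval (scrollPoly k) (f j))) =
          fun j => MvPolynomial.eval (scroll y z) (f j) := by
      intro y z
      funext j
      rw [eval_aeval, eval_scrollPoly]
    refine ⟨d, fun j => MvPolynomial.aeval (scrollPoly k) (f j), ?_, ?_, ?_⟩
    · intro j s t y z
      rw [congrFun (ev _ _) j, congrFun (ev _ _) j, scroll_smul,
        eval_smul_of_isHomogeneous (hf j), mul_pow]
    · rw [ev]
      obtain ⟨a, ha, h⟩ := values_mk hf (scroll y₀ z₀) (scroll_ne_zero hy₀ hz₀)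
      intro h1
      apply hf0
      rw [h1, smul_zero] at h
      exact h
    · intro y z hy hz h0
      obtain ⟨a, ha, h⟩ := values_mk hf (scroll y z) (scroll_ne_zero hy hz)
      have h0' := h0
      rw [ev] at h0'
      have h1 : values f (scrollPoint y z hy hz).1 ≠ 0 := by
        change values f (Projectivization.mk k _ _) ≠ 0
        rw [h]
        exact smul_ne_zero ha h0'
      rw [hfφ _ h1, Projectivization.mk_eq_mk_iff']
      refine ⟨a, ?_⟩
      rw [ev]
      exact h.symm
  have e2 : (fun _ => 1 : Fin 2 → k) ≠ 0 := fun h => one_ne_zero (congrFun h 0)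
  have e3 : (fun _ => 1 : Fin 3 → k) ≠ 0 := fun h => one_ne_zero (congrFun h 0)
  obtain ⟨d, F, hF, hF0, hFφ⟩ := loc _ _ e2 e3
  have hF1 : F ≠ 0 := by
    rintro rfl
    exact hF0 (by funext j; simp)
  -- One local representation, divided by its common factor, is going to serve at every point.
  obtain ⟨h, P, hh, hFP, hP⟩ := exists_eq_mul_isPrimitiveFamily F hF1
  have hP0 : P ≠ 0 := by
    rintro rfl
    exact hF1 (by funext j; simp [hFP])
  obtain ⟨i, hi⟩ := Function.ne_iff.mp hP0
  obtain ⟨c, e, a, b, hca, heb, hhom, -⟩ := (hFP i ▸ hF i).exists_of_mul (mul_ne_zero hh hi)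
  refine ⟨P, a, b, fun j => (hFP j ▸ hF j).right_of_mul hhom hh hca heb, ?_⟩
  intro y z hy hz
  obtain ⟨d', F', hF', hF0', hFφ'⟩ := loc y z hy hz
  have cross : ∀ i j, F i * F' j = F j * F' i := by
    intro i j
    rw [← sub_eq_zero]
    refine eq_zero_of_eval_sumElim fun y z hy hz => ?_
    by_cases h1 : (fun j => MvPolynomial.eval (Sum.elim y z) (F j)) = 0
    · rw [map_sub, map_mul, map_mul, show MvPolynomial.eval (Sum.elim y z) (F i) = 0
        from congrFun h1 i, show MvPolynomial.eval (Sum.elim y z) (F j) = 0 from congrFun h1 j]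
      ring
    by_cases h2 : (fun j => MvPolynomial.eval (Sum.elim y z) (F' j)) = 0
    · rw [map_sub, map_mul, map_mul,
        show MvPolynomial.eval (Sum.elim y z) (F' i) = 0 from congrFun h2 i,
        show MvPolynomial.eval (Sum.elim y z) (F' j) = 0 from congrFun h2 j]
      ring
    have h3 := (hFφ y z hy hz h1).symm.trans (hFφ' y z hy hz h2)
    rw [Projectivization.mk_eq_mk_iff'] at h3
    obtain ⟨r, hr⟩ := h3
    have hri := congrFun hr i
    have hrj := congrFun hr j
    simp only [Pi.smul_apply, smul_eq_mul] at hri hrj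
    rw [map_sub, map_mul, map_mul, ← hri, ← hrj]
    ring
  -- A representation adapted to the given point is a polynomial multiple of `P`, so `P` cannot
  -- vanish there.
  obtain ⟨h', hFP'⟩ := hP.exists_eq_mul hP0 F' fun i j => by
    have := cross i j
    rw [hFP, hFP, mul_assoc, mul_assoc] at this
    exact mul_left_cancel₀ hh this
  have ev : (fun j => MvPolynomial.eval (Sum.elim y z) (F' j)) =
      MvPolynomial.eval (Sum.elim y z) h' • fun j => MvPolynomial.eval (Sum.elim y z) (P j) := by
    funext j
    rw [hFP', map_mul]
    rfl
  have h0 : (fun j => MvPolynomial.eval (Sum.elim y z) (P j)) ≠ 0 := by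
    intro h0
    rw [ev, h0, smul_zero] at hF0'
    exact hF0' rfl
  refine ⟨h0, ?_⟩
  rw [hFφ' y z hy hz hF0', Projectivization.mk_eq_mk_iff']
  exact ⟨_, ev.symm⟩

end Scroll

end ClassicalVariety

namespace ClassicalVariety

/-! ### Lifting automorphisms to the normalization -/

section Lift

variable {k : Type*} [Field k]

/-- A surjective regular self-map of the cubic threefold lifts to its parametrization. -/
theorem exists_lift_of_isRegularMap [Infinite k] [CharZero k]
    (φ : planeCubicThreefold k → planeCubicThreefold k) (hφ : IsRegularMap φ)
    (hsurj : ∀ x, ∃ y z hy hz, φ (scrollPoint y z hy hz) = x) :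
    ∃ (U : Fin 2 → MvPolynomial (Fin 2 ⊕ Fin 3) k) (Z : Fin 3 → MvPolynomial (Fin 2 ⊕ Fin 3) k)
      (a b c d : ℕ), (∀ i, IsBihomogeneous (U i) a b) ∧ (∀ j, IsBihomogeneous (Z j) c d) ∧
      ∀ y z hy hz, ∃ (hU : (fun i => MvPolynomial.eval (Sum.elim y z) (U i)) ≠ 0)
        (hZ : (fun j => MvPolynomial.eval (Sum.elim y z) (Z j)) ≠ 0),
        φ (scrollPoint y z hy hz) = scrollPoint _ _ hU hZ := by
  obtain ⟨P, a, b, hP, hPφ⟩ := exists_forms_of_isRegularMap φ hφ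
  have hP0 : ∀ j, P j ≠ 0 := by
    intro j hj
    have e2 : (fun _ => 1 : Fin 2 → k) ≠ 0 := fun h => one_ne_zero (congrFun h 0)
    have e3 : (fun _ => 1 : Fin 3 → k) ≠ 0 := fun h => one_ne_zero (congrFun h 0)
    -- The all-ones parameters give the point (1, 2, 1, -1, 1). In characteristic zero none of its
    -- coordinates vanishes, so as a value of `φ` it shows that no `P j` is zero.
    obtain ⟨y, z, hy, hz, h⟩ := hsurj (scrollPoint _ _ e2 e3)
    obtain ⟨h0, h1⟩ := hPφ y z hy hz
    rw [h, scrollPoint, Projectivization.mk_eq_mk_iff'] at h1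
    obtain ⟨r, hr⟩ := h1
    have := congrFun hr j
    simp only [hj, Pi.smul_apply, map_zero, smul_zero] at this
    fin_cases j <;> simp [scroll] at this
    norm_num at this
  have hcubic : P 0 * P 3 ^ 2 + P 1 * P 3 * P 4 + P 2 * P 4 ^ 2 = 0 := by
    refine eq_zero_of_eval_sumElim fun y z hy hz => ?_
    obtain ⟨h0, h1⟩ := hPφ y z hy hz
    have := (φ (scrollPoint y z hy hz)).2
    rw [h1, mk_mem_planeCubicThreefold] at this
    simpa using this
  -- On X₀ the ratio y₀ : y₁ is x₄ : -x₃. Removing the common factor of these two components gives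
  -- the lift to ℙ¹, and the factor itself becomes the last coordinate of the lift to ℙ².
  obtain ⟨c, U, hc, hPU, hU⟩ := exists_eq_mul_isPrimitiveFamily ![P 4, - P 3]
    (fun h => hP0 4 (congrFun h 0))
  have h4 : P 4 = c * U 0 := hPU 0
  have h3 : P 3 = - (c * U 1) := by rw [← hPU 1]; simp
  have hU0 : U 0 ≠ 0 := fun h => hP0 4 (by rw [h4, h, mul_zero])
  have hU1 : U 1 ≠ 0 := fun h => hP0 3 (by rw [h3, h, mul_zero, neg_zero])
  have hrel : P 0 * U 1 ^ 2 - P 1 * U 1 * U 0 + P 2 * U 0 ^ 2 = 0 := by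
    refine (mul_eq_zero.mp ?_).resolve_left (pow_ne_zero 2 hc)
    rw [h3, h4] at hcubic
    linear_combination hcubic
  -- The relation modulo `U 0` leaves `P 0 * U 1 ^ 2`, and coprimality of `U 0` and `U 1` is used
  -- once for each factor `U 1`. The case of `U 1` and `P 2` is symmetric.
  obtain ⟨p, hp⟩ : U 0 ∣ P 0 := by
    have h1 : U 0 ∣ U 1 * (U 1 * P 0) := ⟨P 1 * U 1 - P 2 * U 0, by linear_combination hrel⟩
    have h2 : U 0 ∣ U 1 * P 0 := hU _ _ fun j => by
      fin_cases j
      · exact dvd_mul_right _ _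
      · exact h1
    exact hU _ _ fun j => by
      fin_cases j
      · exact dvd_mul_right _ _
      · exact h2
  obtain ⟨q, hq⟩ : U 1 ∣ P 2 := by
    have h1 : U 1 ∣ U 0 * (U 0 * P 2) := ⟨P 1 * U 0 - P 0 * U 1, by linear_combination hrel⟩
    have h2 : U 1 ∣ U 0 * P 2 := hU _ _ fun j => by
      fin_cases j
      · exact h1
      · exact dvd_mul_right _ _
    exact hU _ _ fun j => by
      fin_cases j
      · exact h2
      · exact dvd_mul_right _ _
  have hPs : P = scroll U ![p, q, c] := by
    funext j
    fin_cases j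
    · simpa [scroll] using hp
    · simp only [scroll]
      refine mul_left_cancel₀ (mul_ne_zero hU0 hU1) ?_
      rw [hp, hq] at hrel
      change U 0 * U 1 * P 1 = U 0 * U 1 * (U 0 * q + U 1 * p)
      linear_combination -hrel
    · simpa [scroll] using hq
    · simp [scroll, h3, mul_comm]
    · simp [scroll, h4, mul_comm]
  obtain ⟨e, f, e', f', he, hf, hce, hUe⟩ := (h4 ▸ hP 4).exists_of_mul (h4 ▸ hP0 4)
  have hneg : IsBihomogeneous (c * U 1) a b := fun s t y z => by
    have := hP 3 s t y z
    rw [h3, map_neg, map_neg, mul_neg, neg_inj] at this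
    exact this
  have hUe1 := hneg.right_of_mul hce hc he hf
  refine ⟨U, ![p, q, c], e', f', e, f, ?_, ?_, ?_⟩
  · intro i
    fin_cases i
    · exact hUe
    · exact hUe1
  · intro j
    fin_cases j
    · exact (hp ▸ hP 0).right_of_mul hUe hU0 (by omega) (by omega)
    · exact (hq ▸ hP 2).right_of_mul hUe1 hU1 (by omega) (by omega)
    · exact hce
  · intro y z hy hz
    obtain ⟨h0, h1⟩ := hPφ y z hy hz
    have ev : (fun j => MvPolynomial.eval (Sum.elim y z) (P j)) =
        scroll (fun i => MvPolynomial.eval (Sum.elim y z) (U i))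
          (fun j => MvPolynomial.eval (Sum.elim y z) (![p, q, c] j)) := by
      funext j
      rw [hPs, map_scroll]
    have hU' : (fun i => MvPolynomial.eval (Sum.elim y z) (U i)) ≠ 0 := by
      intro h
      rw [ev, h] at h0
      exact h0 (by simpa using scroll_smul 0 1 (0 : Fin 2 → k) _)
    have hZ' : (fun j => MvPolynomial.eval (Sum.elim y z) (![p, q, c] j)) ≠ 0 := by
      intro h
      rw [ev, h] at h0
      exact h0 (by simpa using scroll_smul 1 0 _ (0 : Fin 3 → k))
    refine ⟨hU', hZ', Subtype.ext ?_⟩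
    rw [h1]
    simp only [ev]
    rfl

theorem eval_aeval_polynomial {σ : Type*} (g : σ → Polynomial k) (F : MvPolynomial σ k) (t : k) :
    Polynomial.eval t (MvPolynomial.aeval g F) =
      MvPolynomial.eval (fun i => Polynomial.eval t (g i)) F := by
  induction F using MvPolynomial.induction_on with
  | C a => simp
  | add p q hp hq => simp [hp, hq]
  | mul_X p i hp => simp [hp]

/-- A form on a plane that vanishes only at the origin is constant. -/
theorem degree_eq_zero_of_nonvanishing [IsAlgClosed k] {σ : Type*} (F : MvPolynomial σ k)
    (u v w : σ → k) (a : ℕ)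
    (hom : ∀ r s t : k, MvPolynomial.eval (u + (r * s) • v + (r * t) • w) F =
      r ^ a * MvPolynomial.eval (u + s • v + t • w) F)
    (nz : ∀ s t : k, (s ≠ 0 ∨ t ≠ 0) → MvPolynomial.eval (u + s • v + t • w) F ≠ 0) : a = 0 := by
  -- Over an algebraically closed field a polynomial without roots is constant. This is applied to
  -- the lines s = 1 and t = 1, and homogeneity compares the two constants.
  have const : ∀ p : Polynomial k, (∀ t, p.eval t ≠ 0) → ∃ c, c ≠ 0 ∧ ∀ t, p.eval t = c := by
    intro p hp
    have hdeg : p.degree = 0 := by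
      by_contra h
      obtain ⟨t, ht⟩ := IsAlgClosed.exists_root p h
      exact hp t ht
    rw [Polynomial.eq_C_of_degree_eq_zero hdeg] at hp ⊢
    exact ⟨_, by simpa using hp 0, fun t => by simp⟩
  have line : ∀ x y : σ → k, ∃ p : Polynomial k, ∀ t, p.eval t = MvPolynomial.eval (x + t • y) F :=
    fun x y => ⟨MvPolynomial.aeval (fun i => Polynomial.C (x i) + Polynomial.X * Polynomial.C (y i))
      F, fun t => by
        rw [eval_aeval_polynomial]
        congr 2
        funext i
        simp [mul_comm t]⟩
  obtain ⟨p, hp⟩ := line (u + v) w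
  obtain ⟨q, hq⟩ := line (u + w) v
  have hp' : ∀ t, p.eval t = MvPolynomial.eval (u + (1 : k) • v + t • w) F := fun t => by
    rw [hp, one_smul]
  have hq' : ∀ t, q.eval t = MvPolynomial.eval (u + t • v + (1 : k) • w) F := fun t => by
    rw [hq, one_smul, add_right_comm]
  obtain ⟨c, hc, hpc⟩ := const p fun t => by rw [hp']; exact nz _ _ (Or.inl one_ne_zero)
  obtain ⟨d, hd, hqd⟩ := const q fun t => by rw [hq']; exact nz _ _ (Or.inr one_ne_zero)
  have key : ∀ t : k, t ≠ 0 → d = t ^ a * c := by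
    intro t ht
    have := hom t 1 t⁻¹
    rw [mul_one, mul_inv_cancel₀ ht, ← hq', ← hp', hpc, hqd] at this
    exact this
  by_contra ha
  -- The comparison is known only for t ≠ 0; the factor `X` extends it to t = 0, where positivity of
  -- `a` would force d = 0.
  have hpoly : (Polynomial.C c * Polynomial.X ^ a - Polynomial.C d) * Polynomial.X = 0 := by
    refine Polynomial.funext fun t => ?_
    by_cases ht : t = 0
    · simp [ht]
    · rw [key t ht]
      simp [mul_comm c]
  have := congrArg (Polynomial.eval 0)
    ((mul_eq_zero.mp hpoly).resolve_right Polynomial.X_ne_zero)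
  simp [ha] at this
  exact hd this

/-- Fixing one group of variables leaves a form on a plane in the other; for the three variables
`z`, the slice z₂ = 0 is enough. -/
theorem IsBihomogeneous.eq_zero_of_nonvanishing [IsAlgClosed k]
    {F : MvPolynomial (Fin 2 ⊕ Fin 3) k} {a b : ℕ} (h : IsBihomogeneous F a b)
    (nz : ∀ y z, y ≠ 0 → z ≠ 0 → MvPolynomial.eval (Sum.elim y z) F ≠ 0) : a = 0 ∧ b = 0 := by
  have e2 : (fun _ => 1 : Fin 2 → k) ≠ 0 := fun h => one_ne_zero (congrFun h 0)
  have e3 : (fun _ => 1 : Fin 3 → k) ≠ 0 := fun h => one_ne_zero (congrFun h 0)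
  have eq1 : ∀ s t : k, (Sum.elim 0 fun _ => 1 : Fin 2 ⊕ Fin 3 → k) + s • Sum.elim ![1, 0] 0 +
      t • Sum.elim ![0, 1] 0 = Sum.elim ![s, t] fun _ => 1 := fun s t => by
    funext i
    rcases i with i | i <;> fin_cases i <;> simp
  have eq2 : ∀ s t : k, (Sum.elim (fun _ => 1) 0 : Fin 2 ⊕ Fin 3 → k) +
      s • Sum.elim (0 : Fin 2 → k) ![1, 0, 0] + t • Sum.elim (0 : Fin 2 → k) ![0, 1, 0] = Sum.elim (fun _ => 1) ![s, t, 0] := fun s t => by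
    funext i
    rcases i with i | i <;> fin_cases i <;> simp
  constructor
  · refine degree_eq_zero_of_nonvanishing F (Sum.elim 0 fun _ => 1) (Sum.elim ![1, 0] 0)
      (Sum.elim ![0, 1] 0) a (fun r s t => ?_) fun s t hst => ?_
    · rw [eq1, eq1]
      simpa using h r 1 ![s, t] (fun _ => 1)
    · rw [eq1]
      refine nz _ _ (fun h0 => ?_) e3
      rcases hst with hs | ht
      · exact hs (congrFun h0 0)
      · exact ht (congrFun h0 1)
  · refine degree_eq_zero_of_nonvanishing F (Sum.elim (fun _ => 1) 0) (Sum.elim 0 ![1, 0, 0])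
      (Sum.elim 0 ![0, 1, 0]) b (fun r s t => ?_) fun s t hst => ?_
    · rw [eq2, eq2]
      simpa using h 1 r (fun _ => 1) ![s, t, 0]
    · rw [eq2]
      refine nz _ _ e2 (fun h0 => ?_)
      rcases hst with hs | ht
      · exact hs (congrFun h0 0)
      · exact ht (congrFun h0 1)

/-- A family of polynomials proportional to a family of variables is a multiple of it. -/
theorem exists_eq_mul_X_of_proportional {σ ι : Type*} [Nontrivial ι] (x : ι → σ)
    (hx : Function.Injective x) (Y : ι → MvPolynomial σ k)
    (h : ∀ i j, Y i * MvPolynomial.X (x j) = Y j * MvPolynomial.X (x i)) :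
    ∃ m, ∀ i, Y i = MvPolynomial.X (x i) * m := by
  obtain ⟨i, j, hij⟩ := exists_pair_ne ι
  have h1 : MvPolynomial.X (x i) ∣ Y i * MvPolynomial.X (x j) := ⟨Y j, by rw [h, mul_comm]⟩
  obtain ⟨m, hm⟩ : MvPolynomial.X (x i) ∣ Y i := by
    refine ((MvPolynomial.X_prime (R := k) (i := x i)).dvd_or_dvd h1).resolve_right fun h2 => ?_
    rw [MvPolynomial.X_dvd_X] at h2
    exact hij (hx h2)
  refine ⟨m, fun l => mul_left_cancel₀ (MvPolynomial.X_ne_zero (R := k) (x i)) ?_⟩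
  have := h l i
  rw [hm] at this
  linear_combination this

/-- Where z₂ ≠ 0 the last two coordinates recover `y` up to a scalar, and then the equations for `z`
are linear. On z₂ = 0 this fails, because there the two factors can be exchanged. -/
theorem scroll_injective {y y' : Fin 2 → k} {z z' : Fin 3 → k} {r : k} (hy : y ≠ 0)
    (hz' : z 2 ≠ 0) (hr : r ≠ 0) (h : scroll y' z' = r • scroll y z) :
    y' 0 * y 1 = y' 1 * y 0 ∧ ∀ i j, z' i * z j = z' j * z i := by
  have h0 : y' 0 * z' 0 = r * (y 0 * z 0) := congrFun h 0
  have h1 : y' 0 * z' 1 + y' 1 * z' 0 = r * (y 0 * z 1 + y 1 * z 0) := congrFun h 1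
  have h2 : y' 1 * z' 1 = r * (y 1 * z 1) := congrFun h 2
  have h3 : -(y' 1 * z' 2) = r * -(y 1 * z 2) := congrFun h 3
  have h4 : y' 0 * z' 2 = r * (y 0 * z 2) := congrFun h 4
  have hne : y 0 ≠ 0 ∨ y 1 ≠ 0 := by
    by_contra! hc
    exact hy (by funext i; fin_cases i <;> simp [hc])
  have hz2 : z' 2 ≠ 0 := by
    intro h5
    rw [h5] at h3 h4
    rcases hne with hc | hc <;> simp_all
  have hyy : y' 0 * y 1 = y' 1 * y 0 := by
    refine mul_left_cancel₀ hz2 (mul_left_cancel₀ (mul_ne_zero hr hz') ?_)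
    linear_combination (r * z 2 * y 1) * h4 + (r * z 2 * y 0) * h3
  refine ⟨hyy, ?_⟩
  obtain ⟨l, rfl⟩ : ∃ l : k, y' = l • y := by
    rcases hne with hc | hc
    · refine ⟨y' 0 / y 0, ?_⟩
      funext i
      fin_cases i
      · simp [hc]
      · simp
        field_simp
        linear_combination -hyy
    · refine ⟨y' 1 / y 1, ?_⟩
      funext i
      fin_cases i
      · simp
        field_simp
        linear_combination hyy
      · simp [hc]
  simp only [Pi.smul_apply, smul_eq_mul] at *
  have hl : l ≠ 0 := by
    rintro rfl
    rcases hne with hc | hc <;> simp_all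
  have k2 : l * z' 2 = r * z 2 := by
    rcases hne with hc | hc
    · refine mul_left_cancel₀ hc ?_
      linear_combination h4
    · refine mul_left_cancel₀ hc ?_
      linear_combination -h3
  have k01 : l * z' 0 = r * z 0 ∧ l * z' 1 = r * z 1 := by
    rcases hne with hc | hc
    · have k0 : l * z' 0 = r * z 0 := mul_left_cancel₀ hc (by linear_combination h0)
      exact ⟨k0, mul_left_cancel₀ hc (by linear_combination h1 - y 1 * k0)⟩
    · have k1 : l * z' 1 = r * z 1 := mul_left_cancel₀ hc (by linear_combination h2)
      exact ⟨mul_left_cancel₀ hc (by linear_combination h1 - y 0 * k1), k1⟩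
  have kk : ∀ i, l * z' i = r * z i := by
    intro i
    fin_cases i
    exacts [k01.1, k01.2, k2]
  intro i j
  refine mul_left_cancel₀ hl ?_
  linear_combination z j * kk i - z i * kk j

/-- If a lift of a self-map of the cubic threefold induces the identity, then it is linear of
bidegrees `(1, 0)` and `(0, 1)`. -/
theorem bidegree_of_lift_eq_id [IsAlgClosed k]
    (U : Fin 2 → MvPolynomial (Fin 2 ⊕ Fin 3) k) (Z : Fin 3 → MvPolynomial (Fin 2 ⊕ Fin 3) k)
    (a b c d : ℕ) (hU : ∀ i, IsBihomogeneous (U i) a b) (hZ : ∀ j, IsBihomogeneous (Z j) c d)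
    (h : ∀ y z hy hz, ∃ (hU : (fun i => MvPolynomial.eval (Sum.elim y z) (U i)) ≠ 0)
        (hZ : (fun j => MvPolynomial.eval (Sum.elim y z) (Z j)) ≠ 0),
        scrollPoint y z hy hz = scrollPoint _ _ hU hZ) : a = 1 ∧ b = 0 ∧ c = 0 ∧ d = 1 := by
  have key : ∀ y z, y ≠ 0 → z 2 ≠ 0 →
      MvPolynomial.eval (Sum.elim y z) (U 0) * y 1 = MvPolynomial.eval (Sum.elim y z) (U 1) * y 0 ∧
      ∀ i j, MvPolynomial.eval (Sum.elim y z) (Z i) * z j =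
        MvPolynomial.eval (Sum.elim y z) (Z j) * z i := by
    intro y z hy hz2
    have hz : z ≠ 0 := fun h => hz2 (congrFun h 2)
    obtain ⟨h1, h2, h3⟩ := h y z hy hz
    have h4 := congrArg Subtype.val h3
    rw [scrollPoint, scrollPoint, Projectivization.mk_eq_mk_iff'] at h4
    obtain ⟨r, hr⟩ := h4
    have hr0 : r ≠ 0 := by
      rintro rfl
      rw [zero_smul] at hr
      exact scroll_ne_zero hy hz hr.symm
    refine scroll_injective (y' := fun i => MvPolynomial.eval (Sum.elim y z) (U i))
      (z' := fun i => MvPolynomial.eval (Sum.elim y z) (Z i)) (r := r⁻¹) hy hz2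
      (inv_ne_zero hr0) ?_
    rw [← hr, smul_smul, inv_mul_cancel₀ hr0, one_smul]
  -- Injectivity is available only where z₂ ≠ 0, but polynomial identities extend from there.
  have poly : ∀ F : MvPolynomial (Fin 2 ⊕ Fin 3) k,
      (∀ y z, y ≠ 0 → z 2 ≠ 0 → MvPolynomial.eval (Sum.elim y z) F = 0) → F = 0 := by
    intro F hF
    have : F * MvPolynomial.X (Sum.inr 2) = 0 := by
      refine eq_zero_of_eval_sumElim fun y z hy _ => ?_
      by_cases h2 : z 2 = 0
      · simp [h2]
      · simp [hF y z hy h2]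
    exact (mul_eq_zero.mp this).resolve_right (MvPolynomial.X_ne_zero _)
  have hUprop : ∀ i j, U i * MvPolynomial.X (Sum.inl j) = U j * MvPolynomial.X (Sum.inl i) := by
    have h01 : U 0 * MvPolynomial.X (Sum.inl 1) = U 1 * MvPolynomial.X (Sum.inl 0) := by
      rw [← sub_eq_zero]
      refine poly _ fun y z hy hz => ?_
      simpa [sub_eq_zero] using (key y z hy hz).1
    intro i j
    fin_cases i <;> fin_cases j
    · rfl
    · exact h01
    · exact h01.symm
    · rfl
  have hZprop : ∀ i j, Z i * MvPolynomial.X (Sum.inr j) = Z j * MvPolynomial.X (Sum.inr i) := by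
    intro i j
    rw [← sub_eq_zero]
    refine poly _ fun y z hy hz => ?_
    simpa [sub_eq_zero] using (key y z hy hz).2 i j
  obtain ⟨m, hm⟩ := exists_eq_mul_X_of_proportional Sum.inl Sum.inl_injective U hUprop
  obtain ⟨n, hn⟩ := exists_eq_mul_X_of_proportional Sum.inr Sum.inr_injective Z hZprop
  -- A zero of the multiplier would be a point where the lift is undefined; hence the multipliers
  -- `m` and `n` have bidegree (0, 0).
  have hm' : ∀ y z, y ≠ 0 → z ≠ 0 → MvPolynomial.eval (Sum.elim y z) m ≠ 0 := by
    intro y z hy hz h0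
    obtain ⟨h1, h2, h3⟩ := h y z hy hz
    exact h1 (by funext i; simp [hm, h0])
  have hn' : ∀ y z, y ≠ 0 → z ≠ 0 → MvPolynomial.eval (Sum.elim y z) n ≠ 0 := by
    intro y z hy hz h0
    obtain ⟨h1, h2, h3⟩ := h y z hy hz
    exact h2 (by funext i; simp [hn, h0])
  have e2 : (fun _ => 1 : Fin 2 → k) ≠ 0 := fun h => one_ne_zero (congrFun h 0)
  have e3 : (fun _ => 1 : Fin 3 → k) ≠ 0 := fun h => one_ne_zero (congrFun h 0)
  have hm0 : m ≠ 0 := by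
    rintro rfl
    exact hm' _ _ e2 e3 (map_zero _)
  have hn0 : n ≠ 0 := by
    rintro rfl
    exact hn' _ _ e2 e3 (map_zero _)
  have hXl : IsBihomogeneous (MvPolynomial.X (Sum.inl 0) : MvPolynomial (Fin 2 ⊕ Fin 3) k) 1 0 :=
    fun s t y z => by simp
  have hXr : IsBihomogeneous (MvPolynomial.X (Sum.inr 0) : MvPolynomial (Fin 2 ⊕ Fin 3) k) 0 1 :=
    fun s t y z => by simp
  obtain ⟨p, q, p', q', rfl, rfl, h1, h2⟩ :=
    (hm 0 ▸ hU 0).exists_of_mul (mul_ne_zero (MvPolynomial.X_ne_zero _) hm0)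
  obtain ⟨rfl, rfl⟩ := h1.unique hXl (MvPolynomial.X_ne_zero _)
  obtain ⟨rfl, rfl⟩ := h2.eq_zero_of_nonvanishing hm'
  obtain ⟨p, q, p', q', rfl, rfl, h1, h2⟩ :=
    (hn 0 ▸ hZ 0).exists_of_mul (mul_ne_zero (MvPolynomial.X_ne_zero _) hn0)
  obtain ⟨rfl, rfl⟩ := h1.unique hXr (MvPolynomial.X_ne_zero _)
  obtain ⟨rfl, rfl⟩ := h2.eq_zero_of_nonvanishing hn'
  exact ⟨rfl, rfl, rfl, rfl⟩

/-- A polynomial that is homogeneous of degree one as a function is a linear form. -/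
theorem exists_linearMap_of_homogeneous_one [Infinite k] {σ : Type*} (F : MvPolynomial σ k)
    (h : ∀ (t : k) (v : σ → k), MvPolynomial.eval (t • v) F = t * MvPolynomial.eval v F) :
    ∃ l : (σ → k) →ₗ[k] k, ∀ v, MvPolynomial.eval v F = l v := by
  have h1 : F = MvPolynomial.homogeneousComponent 1 F := by
    refine MvPolynomial.funext fun v => ?_
    -- `p` is F(Tv) as a polynomial in T; its linear coefficient is the component of degree one
    -- evaluated at `v`.
    let p : Polynomial k := ∑ i ∈ Finset.range (F.totalDegree + 1),
      Polynomial.C (MvPolynomial.eval v (MvPolynomial.homogeneousComponent i F)) * Polynomial.X ^ i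
    have hp : p = Polynomial.C (MvPolynomial.eval v F) * Polynomial.X := by
      refine Polynomial.funext fun t => ?_
      simp only [p, Polynomial.eval_finsetSum, Polynomial.eval_mul, Polynomial.eval_C,
        Polynomial.eval_pow, Polynomial.eval_X]
      rw [mul_comm, ← h]
      conv_rhs => rw [← MvPolynomial.sum_homogeneousComponent F]
      rw [map_sum]
      refine Finset.sum_congr rfl fun i _ => ?_
      rw [eval_smul_of_isHomogeneous (MvPolynomial.homogeneousComponent_isHomogeneous i F),
        mul_comm]
    have hc := congrArg (fun p => Polynomial.coeff p 1) hp
    simp only [p, Polynomial.finsetSum_coeff, Polynomial.coeff_C_mul_X_pow,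
      Polynomial.coeff_C_mul_X] at hc
    simp only [Finset.sum_ite_eq, Finset.mem_range, if_true] at hc
    rw [← hc]
    split_ifs with h2
    · rfl
    · rw [MvPolynomial.homogeneousComponent_eq_zero _ _ (by omega), map_zero]
  have h2 : F ∈ Submodule.span k (Set.range (MvPolynomial.X : σ → MvPolynomial σ k)) := by
    rw [← MvPolynomial.homogeneousSubmodule_one_eq_span_X, MvPolynomial.mem_homogeneousSubmodule]
    rw [h1]
    exact MvPolynomial.homogeneousComponent_isHomogeneous 1 F
  refine Submodule.span_induction (p := fun F _ => ∃ l : (σ → k) →ₗ[k] k,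
    ∀ v, MvPolynomial.eval v F = l v) ?_ ?_ ?_ ?_ h2
  · rintro _ ⟨i, rfl⟩
    exact ⟨LinearMap.proj i, fun v => by simp⟩
  · exact ⟨0, fun v => by simp⟩
  · rintro x y - - ⟨l, hl⟩ ⟨l', hl'⟩
    exact ⟨l + l', fun v => by simp [hl, hl']⟩
  · rintro a x - ⟨l, hl⟩
    exact ⟨a • l, fun v => by simp [hl, MvPolynomial.smul_eval]⟩

theorem IsBihomogeneous.exists_linearMap_left [Infinite k] {ι κ : Type*}
    {F : MvPolynomial (ι ⊕ κ) k} (h : IsBihomogeneous F 1 0) :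
    ∃ l : (ι → k) →ₗ[k] k, ∀ y z, MvPolynomial.eval (Sum.elim y z) F = l y := by
  obtain ⟨l, hl⟩ := exists_linearMap_of_homogeneous_one F fun t v => by
    have := h t t (v ∘ Sum.inl) (v ∘ Sum.inr)
    rw [show Sum.elim (t • v ∘ Sum.inl) (t • v ∘ Sum.inr) = t • v from
      Sum.elim_comp_inl_inr (t • v), Sum.elim_comp_inl_inr] at this
    simpa using this
  refine ⟨l ∘ₗ LinearMap.pi (Sum.elim LinearMap.proj 0), fun y z => ?_⟩
  -- Since 0 ^ 0 = 1, degree zero in the second group allows replacing `z` by 0.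
  have := h 1 0 y z
  simp only [one_smul, zero_smul, one_pow, pow_zero, mul_one, one_mul] at this
  rw [← this, hl]
  simp only [LinearMap.comp_apply]
  congr 1
  funext i
  rcases i with i | i <;> simp

theorem IsBihomogeneous.exists_linearMap_right [Infinite k] {ι κ : Type*}
    {F : MvPolynomial (ι ⊕ κ) k} (h : IsBihomogeneous F 0 1) :
    ∃ l : (κ → k) →ₗ[k] k, ∀ y z, MvPolynomial.eval (Sum.elim y z) F = l z := by
  obtain ⟨l, hl⟩ := exists_linearMap_of_homogeneous_one F fun t v => by
    have := h t t (v ∘ Sum.inl) (v ∘ Sum.inr)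
    rw [show Sum.elim (t • v ∘ Sum.inl) (t • v ∘ Sum.inr) = t • v from
      Sum.elim_comp_inl_inr (t • v), Sum.elim_comp_inl_inr] at this
    simpa using this
  refine ⟨l ∘ₗ LinearMap.pi (Sum.elim 0 LinearMap.proj), fun y z => ?_⟩
  have := h 0 1 y z
  simp only [one_smul, zero_smul, one_pow, pow_zero, mul_one, one_mul] at this
  rw [← this, hl]
  simp only [LinearMap.comp_apply]
  congr 1
  funext i
  rcases i with i | i <;> simp

theorem exists_ne_zero_apply_eq_zero_of_two_forms (l l' : (Fin 3 → k) →ₗ[k] k) :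
    ∃ z : Fin 3 → k, z ≠ 0 ∧ l z = 0 ∧ l' z = 0 := by
  have h : LinearMap.ker (l.prod l') ≠ ⊥ := by
    apply LinearMap.ker_ne_bot_of_finrank_lt
    simp
  obtain ⟨z, hz, hz0⟩ := Submodule.exists_mem_ne_zero_of_ne_bot h
  rw [LinearMap.mem_ker, LinearMap.prod_apply] at hz
  exact ⟨z, hz0, congrArg Prod.fst hz, congrArg Prod.snd hz⟩

/-- An invertible `2 × 2` matrix of natural numbers is a permutation matrix. -/
theorem eq_one_or_swap_of_mul_eq_one {a b c d a' b' c' d' : ℕ} (h1 : a * a' + c * b' = 1)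
    (h2 : b * a' + d * b' = 0) (h3 : a * c' + c * d' = 0) (h4 : b * c' + d * d' = 1) :
    (a = 1 ∧ b = 0 ∧ c = 0 ∧ d = 1) ∨ (a = 0 ∧ b = 1) := by
  obtain ⟨h5, h6⟩ := Nat.add_eq_zero_iff.mp h2
  obtain ⟨h7, h8⟩ := Nat.add_eq_zero_iff.mp h3
  rcases Nat.mul_eq_zero.mp h5 with rfl | rfl
  · left
    rw [zero_mul, zero_add] at h4
    obtain ⟨rfl, rfl⟩ := mul_eq_one.mp h4
    rw [mul_one] at h8
    rw [h8, zero_mul, add_zero] at h1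
    exact ⟨(mul_eq_one.mp h1).1, rfl, h8, rfl⟩
  · right
    rw [mul_zero, zero_add] at h1
    obtain ⟨rfl, rfl⟩ := mul_eq_one.mp h1
    rw [mul_one] at h6
    rw [h6, zero_mul, add_zero] at h4
    obtain ⟨rfl, rfl⟩ := mul_eq_one.mp h4
    exact ⟨by rwa [mul_one] at h7, rfl⟩

/-- Every automorphism of the cubic threefold is induced by a pair of linear maps. -/
theorem exists_linear_lift [IsAlgClosed k] [CharZero k] (g : VarAut (planeCubicThreefold k)) :
    ∃ (A : (Fin 2 → k) →ₗ[k] (Fin 2 → k)) (B : (Fin 3 → k) →ₗ[k] (Fin 3 → k)),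
      ∀ y z hy hz, ∃ (hA : A y ≠ 0) (hB : B z ≠ 0),
        g.1 (scrollPoint y z hy hz) = scrollPoint (A y) (B z) hA hB := by
  have surj : ∀ e : Equiv.Perm (planeCubicThreefold k), ∀ x, ∃ y z hy hz,
      e (scrollPoint y z hy hz) = x := by
    intro e x
    obtain ⟨y, z, hy, hz, h⟩ := exists_scrollPoint_eq (e.symm x)
    exact ⟨y, z, hy, hz, by rw [← h, Equiv.apply_symm_apply]⟩
  obtain ⟨U, Z, a, b, c, d, hU, hZ, hg⟩ := exists_lift_of_isRegularMap g.1 g.2.1 (surj _)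
  obtain ⟨U', Z', a', b', c', d', hU', hZ', hg'⟩ :=
    exists_lift_of_isRegularMap g.1.symm g.2.2 (surj _)
  have ev : ∀ (F : MvPolynomial (Fin 2 ⊕ Fin 3) k) y z,
      MvPolynomial.eval (Sum.elim y z) (MvPolynomial.aeval (Sum.elim U Z) F) =
      MvPolynomial.eval (Sum.elim (fun i => MvPolynomial.eval (Sum.elim y z) (U i))
        (fun j => MvPolynomial.eval (Sum.elim y z) (Z j))) F := by
    intro F y z
    rw [eval_aeval]
    congr 2
    funext i
    rcases i with i | i <;> simp
  -- Composition of lifts multiplies their 2 × 2 matrices of bidegrees.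
  have hom : ∀ (F : MvPolynomial (Fin 2 ⊕ Fin 3) k) p q, IsBihomogeneous F p q →
      IsBihomogeneous (MvPolynomial.aeval (Sum.elim U Z) F) (a * p + c * q) (b * p + d * q) := by
    intro F p q hF s t y z
    rw [ev, ev]
    have e1 : (fun i => MvPolynomial.eval (Sum.elim (s • y) (t • z)) (U i)) =
        (s ^ a * t ^ b) • fun i => MvPolynomial.eval (Sum.elim y z) (U i) :=
      funext fun i => hU i s t y z
    have e2 : (fun i => MvPolynomial.eval (Sum.elim (s • y) (t • z)) (Z i)) =
        (s ^ c * t ^ d) • fun i => MvPolynomial.eval (Sum.elim y z) (Z i) :=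
      funext fun i => hZ i s t y z
    rw [e1, e2, hF]
    ring
  -- The composite of the two lifts induces the identity of X₀, so the product of the bidegree
  -- matrices is the identity matrix.
  obtain ⟨h1, h2, h3, h4⟩ := bidegree_of_lift_eq_id
    (fun i => MvPolynomial.aeval (Sum.elim U Z) (U' i))
    (fun i => MvPolynomial.aeval (Sum.elim U Z) (Z' i)) _ _ _ _
    (fun i => hom _ _ _ (hU' i)) (fun i => hom _ _ _ (hZ' i)) (by
      intro y z hy hz
      obtain ⟨h1, h2, h3⟩ := hg y z hy hz
      obtain ⟨h4, h5, h6⟩ := hg' _ _ h1 h2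
      rw [← h3, Equiv.symm_apply_apply] at h6
      simp only [ev]
      exact ⟨h4, h5, h6⟩)
  rcases eq_one_or_swap_of_mul_eq_one h1 h2 h3 h4 with ⟨rfl, rfl, rfl, rfl⟩ | ⟨rfl, rfl⟩
  · choose A hA using fun i => (hU i).exists_linearMap_left
    choose B hB using fun i => (hZ i).exists_linearMap_right
    refine ⟨LinearMap.pi A, LinearMap.pi B, fun y z hy hz => ?_⟩
    obtain ⟨h1, h2, h3⟩ := hg y z hy hz
    simp only [hA, hB] at h1 h2 h3
    exact ⟨h1, h2, h3⟩
  -- If the bidegrees were exchanged, the ℙ¹-component would consist of two linear forms in three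
  -- variables, which have a common zero.
  · exfalso
    choose l hl using fun i => (hU i).exists_linearMap_right
    obtain ⟨z, hz, hz0, hz1⟩ := exists_ne_zero_apply_eq_zero_of_two_forms (l 0) (l 1)
    have e2 : (fun _ => 1 : Fin 2 → k) ≠ 0 := fun h => one_ne_zero (congrFun h 0)
    obtain ⟨h1, -, -⟩ := hg _ z e2 hz
    refine h1 (funext fun i => ?_)
    rw [hl]
    fin_cases i
    exacts [hz0, hz1]

end Lift

end ClassicalVariety

namespace ClassicalVariety

/-! ### The automorphism group acts by affine transformations of the plane -/

section Representations

variable {k : Type*} [Field k]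

/-- The inclusion of the plane `z₂ = 0`. -/
def planeInclusion (k : Type*) [Field k] : (Fin 2 → k) →ₗ[k] (Fin 3 → k) where
  toFun y := ![y 0, y 1, 0]
  map_add' y y' := by funext i; fin_cases i <;> simp
  map_smul' a y := by funext i; fin_cases i <;> simp

/-- The projection to the first two coordinates. -/
def planeProjection (k : Type*) [Field k] : (Fin 3 → k) →ₗ[k] (Fin 2 → k) where
  toFun z := ![z 0, z 1]
  map_add' y y' := by funext i; fin_cases i <;> simp
  map_smul' a y := by funext i; fin_cases i <;> simp

theorem planeInclusion_apply (y : Fin 2 → k) : planeInclusion k y = ![y 0, y 1, 0] := rfl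

theorem planeProjection_apply (z : Fin 3 → k) : planeProjection k z = ![z 0, z 1] := rfl

theorem planeInclusion_planeProjection (z : Fin 3 → k) (hz : z 2 = 0) :
    planeInclusion k (planeProjection k z) = z := by
  funext i
  fin_cases i <;> simp [planeInclusion_apply, planeProjection_apply, hz]

theorem planeInclusion_ne_zero {y : Fin 2 → k} (hy : y ≠ 0) : planeInclusion k y ≠ 0 := by
  intro h
  refine hy (funext fun i => ?_)
  fin_cases i
  · exact congrFun h 0
  · exact congrFun h 1

/-- The upper left `2 × 2` block of an endomorphism. -/
def planeBlock (B : (Fin 3 → k) →ₗ[k] (Fin 3 → k)) : (Fin 2 → k) →ₗ[k] (Fin 2 → k) :=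
  planeProjection k ∘ₗ B ∘ₗ planeInclusion k

theorem planeBlock_apply (B : (Fin 3 → k) →ₗ[k] (Fin 3 → k)) (y : Fin 2 → k) :
    planeBlock B y = planeProjection k (B (planeInclusion k y)) := rfl

/-- On z₂ = 0 the first three coordinates are the coefficients of a product of two binary linear
forms, and multiplication is commutative. This is the gluing that ties the two factors together. -/
theorem scroll_planeInclusion_comm (y z : Fin 2 → k) :
    scroll y (planeInclusion k z) = scroll z (planeInclusion k y) := by
  funext i
  fin_cases i <;> simp [scroll, planeInclusion_apply] <;> ring

/-- An injective endomorphism of the plane preserves linear independence of two vectors. -/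
theorem det_eq_zero_of_apply (A : (Fin 2 → k) →ₗ[k] (Fin 2 → k)) (hA : ∀ y, y ≠ 0 → A y ≠ 0)
    (y z : Fin 2 → k) (h : A y 0 * A z 1 = A y 1 * A z 0) : y 0 * z 1 = y 1 * z 0 := by
  by_contra hne
  have comb : ∀ s t : k, A (s • y + t • z) = 0 → s = 0 ∧ t = 0 := by
    intro s t h0
    have h1 : s • y + t • z = 0 := by
      by_contra h2
      exact hA _ h2 h0
    have e0 : s * y 0 + t * z 0 = 0 := congrFun h1 0
    have e1 : s * y 1 + t * z 1 = 0 := congrFun h1 1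
    constructor
    · refine ((mul_eq_zero (b := y 0 * z 1 - y 1 * z 0)).mp ?_).resolve_right (sub_ne_zero.mpr hne)
      linear_combination z 1 * e0 - z 0 * e1
    · refine ((mul_eq_zero (b := y 0 * z 1 - y 1 * z 0)).mp ?_).resolve_right (sub_ne_zero.mpr hne)
      linear_combination y 0 * e1 - y 1 * e0
  have h0 := comb (A z 0) (- A y 0) (by
    funext i
    fin_cases i <;> simp
    · ring
    · linear_combination -h)
  have h1 := comb (A z 1) (- A y 1) (by
    funext i
    fin_cases i <;> simp
    · linear_combination h
    · ring)
  have hy : y ≠ 0 := by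
    rintro rfl
    simp at hne
  refine hA y hy (funext fun i => ?_)
  fin_cases i
  · simpa using h0.2
  · simpa using h1.2

theorem exists_det_ne_zero {y : Fin 2 → k} (hy : y ≠ 0) :
    ∃ z : Fin 2 → k, z ≠ 0 ∧ y 0 * z 1 ≠ y 1 * z 0 := by
  by_cases h0 : y 0 = 0
  · have h1 : y 1 ≠ 0 := fun h1 => hy (by funext i; fin_cases i <;> assumption)
    exact ⟨![1, 0], fun h => one_ne_zero (congrFun h 0), by simpa using h1.symm⟩
  · exact ⟨![0, 1], fun h => one_ne_zero (congrFun h 1), by simpa using h0⟩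

theorem exists_smul_eq_of_det_eq_zero {y z : Fin 2 → k} (hy : y ≠ 0)
    (h : y 0 * z 1 = y 1 * z 0) : ∃ c : k, z = c • y := by
  by_cases h0 : y 0 = 0
  · have h1 : y 1 ≠ 0 := fun h1 => hy (by funext i; fin_cases i <;> assumption)
    refine ⟨z 1 / y 1, funext fun i => ?_⟩
    fin_cases i
    · simp [h0] at h ⊢
      tauto
    · simp [h1]
  · refine ⟨z 0 / y 0, funext fun i => ?_⟩
    fin_cases i
    · simp [h0]
    · simp
      field_simp
      linear_combination h

theorem scrollPoint_eq_iff {y y' : Fin 2 → k} {z z' : Fin 3 → k} {hy : y ≠ 0} {hz : z ≠ 0}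
    {hy' : y' ≠ 0} {hz' : z' ≠ 0} : scrollPoint y z hy hz = scrollPoint y' z' hy' hz' ↔
      ∃ r : k, r • scroll y' z' = scroll y z := by
  rw [Subtype.ext_iff, scrollPoint, scrollPoint, Projectivization.mk_eq_mk_iff']

theorem scrollPoint_smul_eq {y : Fin 2 → k} {z : Fin 3 → k} {s t : k} (hy : y ≠ 0) (hz : z ≠ 0)
    (hy' : s • y ≠ 0) (hz' : t • z ≠ 0) :
    scrollPoint (s • y) (t • z) hy' hz' = scrollPoint y z hy hz :=
  scrollPoint_eq_iff.2 ⟨s * t, (scroll_smul s t y z).symm⟩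

/-- Every automorphism of the cubic threefold is induced by an affine transformation of the plane
and its linear part. -/
theorem exists_affine_lift [IsAlgClosed k] [CharZero k] (g : VarAut (planeCubicThreefold k)) :
    ∃ B : (Fin 3 → k) →ₗ[k] (Fin 3 → k), (∀ z, B z 2 = z 2) ∧
      ∀ y z hy hz, ∃ (hA : planeBlock B y ≠ 0) (hB : B z ≠ 0),
        g.1 (scrollPoint y z hy hz) = scrollPoint (planeBlock B y) (B z) hA hB := by
  obtain ⟨A, B, hg⟩ := exists_linear_lift g
  have e2 : (fun _ => 1 : Fin 2 → k) ≠ 0 := fun h => one_ne_zero (congrFun h 0)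
  have e3 : (fun _ => 1 : Fin 3 → k) ≠ 0 := fun h => one_ne_zero (congrFun h 0)
  have hA : ∀ y, y ≠ 0 → A y ≠ 0 := fun y hy => (hg y _ hy e3).1
  have hB : ∀ z, z ≠ 0 → B z ≠ 0 := fun z hz => (hg _ z e2 hz).2.1
  -- The lift must send identified points to identified points.
  have comm : ∀ y z : Fin 2 → k, y ≠ 0 → z ≠ 0 → ∃ r : k, r ≠ 0 ∧
      scroll (A y) (B (planeInclusion k z)) = r • scroll (A z) (B (planeInclusion k y)) := by
    intro y z hy hz
    obtain ⟨h1, h2, h3⟩ := hg y _ hy (planeInclusion_ne_zero hz)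
    obtain ⟨h4, h5, h6⟩ := hg z _ hz (planeInclusion_ne_zero hy)
    have : scrollPoint y _ hy (planeInclusion_ne_zero hz) =
        scrollPoint z _ hz (planeInclusion_ne_zero hy) :=
      scrollPoint_eq_iff.2 ⟨1, by rw [one_smul, scroll_planeInclusion_comm]⟩
    rw [this, h6, scrollPoint_eq_iff] at h3
    obtain ⟨r, hr⟩ := h3
    have hr0 : r ≠ 0 := by
      rintro rfl
      rw [zero_smul] at hr
      exact scroll_ne_zero h4 h5 hr.symm
    exact ⟨r⁻¹, inv_ne_zero hr0, by rw [← hr, smul_smul, inv_mul_cancel₀ hr0, one_smul]⟩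
  -- Otherwise the image lies where the parametrization is injective, which makes A z and A y
  -- proportional for some `y` independent of `z`.
  have third : ∀ z : Fin 2 → k, B (planeInclusion k z) 2 = 0 := by
    intro z
    by_contra hne
    have hz : z ≠ 0 := by
      rintro rfl
      simp at hne
    obtain ⟨y, hy, hyz⟩ := exists_det_ne_zero hz
    obtain ⟨r, hr, h⟩ := comm z y hz hy
    have h1 := (scroll_injective (hA y hy) hne hr h).1
    exact hyz (det_eq_zero_of_apply A hA z y h1)
  have block : ∀ y, y ≠ 0 → planeBlock B y ≠ 0 := by
    intro y hy h0
    refine hB _ (planeInclusion_ne_zero hy) ?_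
    rw [← planeInclusion_planeProjection _ (third y), ← planeBlock_apply, h0, map_zero]
  have par : ∀ y, y ≠ 0 → ∃ c : k, c ≠ 0 ∧ planeBlock B y = c • A y := by
    intro y hy
    obtain ⟨z, hz, hyz⟩ := exists_det_ne_zero hy
    obtain ⟨r, hr, h⟩ := comm y z hy hz
    have h0 : A y 0 * B (planeInclusion k z) 0 = r * (A z 0 * B (planeInclusion k y) 0) :=
      congrFun h 0
    have h1 : A y 0 * B (planeInclusion k z) 1 + A y 1 * B (planeInclusion k z) 0 =
      r * (A z 0 * B (planeInclusion k y) 1 + A z 1 * B (planeInclusion k y) 0) := congrFun h 1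
    have h2 : A y 1 * B (planeInclusion k z) 1 = r * (A z 1 * B (planeInclusion k y) 1) :=
      congrFun h 2
    have h3 : A y 0 * A z 1 - A y 1 * A z 0 ≠ 0 :=
      fun h3 => hyz (det_eq_zero_of_apply A hA y z (sub_eq_zero.mp h3))
    have h4 : A y 0 * planeBlock B y 1 = A y 1 * planeBlock B y 0 := by
      -- Evaluating the product of binary forms at the zero of the factor A y kills the left side.
      -- The right side factors into det(A y, A z) and the determinant of A y with the block of B at
      -- y.
      refine mul_left_cancel₀ (mul_ne_zero hr h3) ?_
      simp only [planeBlock_apply, planeProjection_apply, Matrix.cons_val_zero,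
        Matrix.cons_val_one]
      linear_combination -(A y 1) ^ 2 * h0 + A y 0 * A y 1 * h1 - (A y 0) ^ 2 * h2
    obtain ⟨c, hc⟩ := exists_smul_eq_of_det_eq_zero (hA y hy) h4
    refine ⟨c, ?_, hc⟩
    rintro rfl
    exact block y hy (by rw [hc, zero_smul])
  -- As B preserves z₂ = 0, its last coordinate is β z₂, and β ≠ 0 by injectivity; dividing by β
  -- fixes z₂.
  set β := B ![0, 0, 1] 2 with hβ
  have hlast : ∀ z, B z 2 = β * z 2 := by
    intro z
    have : z = planeInclusion k (planeProjection k z) + z 2 • ![0, 0, 1] := by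
      funext i
      fin_cases i <;> simp [planeInclusion_apply, planeProjection_apply]
    conv_lhs => rw [this]
    rw [map_add, Pi.add_apply, third, map_smul, Pi.smul_apply, smul_eq_mul, zero_add, mul_comm]
  have hβ0 : β ≠ 0 := by
    intro h0
    obtain ⟨z, hz, hz0, hz1⟩ := exists_ne_zero_apply_eq_zero_of_two_forms
      (LinearMap.proj 0 ∘ₗ B) (LinearMap.proj 1 ∘ₗ B)
    refine hB z hz (funext fun i => ?_)
    fin_cases i
    · exact hz0
    · exact hz1
    · simp [hlast, h0]
  have hblock : ∀ y, planeBlock (β⁻¹ • B) y = β⁻¹ • planeBlock B y := fun y => by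
    simp [planeBlock_apply]
  refine ⟨β⁻¹ • B, fun z => by simp [hlast, hβ0], fun y z hy hz => ?_⟩
  obtain ⟨h1, h2, h3⟩ := hg y z hy hz
  obtain ⟨c, hc, hyc⟩ := par y hy
  refine ⟨by rw [hblock]; exact smul_ne_zero (inv_ne_zero hβ0) (block y hy),
    smul_ne_zero (inv_ne_zero hβ0) h2, ?_⟩
  rw [h3]
  simp only [hblock, hyc, smul_smul]
  -- The scalar `c` may depend on `y`, which is harmless since only the projective point matters.
  exact (scrollPoint_smul_eq h1 h2 _ _).symm

/-- Where z₂ ≠ 0 injectivity of the parametrization makes B z and C z proportional, and equal last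
coordinates make them equal; such vectors span. Uniqueness is what turns the chosen lifts into
homomorphisms. -/
theorem affine_lift_unique [CharZero k] (B C : (Fin 3 → k) →ₗ[k] (Fin 3 → k))
    (hC2 : ∀ z, C z 2 = z 2) (hB2 : ∀ z, B z 2 = z 2)
    (φ : planeCubicThreefold k → planeCubicThreefold k)
    (hB : ∀ y z hy hz, ∃ (hA : planeBlock B y ≠ 0) (hB : B z ≠ 0),
        φ (scrollPoint y z hy hz) = scrollPoint (planeBlock B y) (B z) hA hB)
    (hC : ∀ y z hy hz, ∃ (hA : planeBlock C y ≠ 0) (hB : C z ≠ 0),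
        φ (scrollPoint y z hy hz) = scrollPoint (planeBlock C y) (C z) hA hB) : B = C := by
  have e2 : (fun _ => 1 : Fin 2 → k) ≠ 0 := fun h => one_ne_zero (congrFun h 0)
  have key : ∀ z, z 2 ≠ 0 → B z = C z := by
    intro z hz2
    have hz : z ≠ 0 := fun h => hz2 (congrFun h 2)
    obtain ⟨h1, h2, h3⟩ := hB _ z e2 hz
    obtain ⟨h4, h5, h6⟩ := hC _ z e2 hz
    rw [h3, scrollPoint_eq_iff] at h6
    obtain ⟨r, hr⟩ := h6
    have hr0 : r ≠ 0 := by
      rintro rfl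
      rw [zero_smul] at hr
      exact scroll_ne_zero h1 h2 hr.symm
    have := (scroll_injective h4 (by rw [hC2]; exact hz2) hr0 hr.symm).2
    funext i
    have h7 := this i 2
    rw [hB2, hC2] at h7
    exact mul_right_cancel₀ hz2 (by rw [h7, mul_comm])
  refine LinearMap.ext fun z => ?_
  by_cases hz : z 2 = 0
  · have h1 := key (z + ![0, 0, 1]) (by simp [hz])
    rw [map_add, map_add, key ![0, 0, 1] (by simp)] at h1
    exact add_right_cancel h1
  · exact key z hz

/-- Since C preserves the plane z₂ = 0, no information is lost by projecting between the two maps.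
-/
theorem planeBlock_comp (B C : (Fin 3 → k) →ₗ[k] (Fin 3 → k)) (hC : ∀ z, C z 2 = z 2) :
    planeBlock (B ∘ₗ C) = planeBlock B ∘ₗ planeBlock C := by
  refine LinearMap.ext fun y => ?_
  simp only [planeBlock_apply, LinearMap.comp_apply]
  rw [planeInclusion_planeProjection _ (by rw [hC]; rfl)]

theorem planeBlock_id : planeBlock (LinearMap.id : (Fin 3 → k) →ₗ[k] (Fin 3 → k)) =
    LinearMap.id := by
  refine LinearMap.ext fun y => ?_
  funext i
  fin_cases i <;> simp [planeBlock_apply, planeInclusion_apply, planeProjection_apply]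

/-- The automorphism group of the cubic threefold acts linearly on its parametrization. -/
theorem exists_representations [IsAlgClosed k] [CharZero k] :
    ∃ (ρ : VarAut (planeCubicThreefold k) →* LinearMap.GeneralLinearGroup k (Fin 2 → k))
      (σ : VarAut (planeCubicThreefold k) →* LinearMap.GeneralLinearGroup k (Fin 3 → k)),
      Function.Injective σ ∧ (∀ g (z : Fin 3 → k), (σ g • z) 2 = z 2) ∧
      ∀ g y z hy hz, g.1 (scrollPoint y z hy hz) = scrollPoint (ρ g • y) (σ g • z)
        ((smul_ne_zero_iff_ne _).mpr hy) ((smul_ne_zero_iff_ne _).mpr hz) := by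
  choose B hB2 hB using exists_affine_lift (k := k)
  have one : B 1 = LinearMap.id := by
    refine affine_lift_unique _ _ (fun _ => rfl) (hB2 1) _ (hB 1) fun y z hy hz => ?_
    simp only [planeBlock_id]
    exact ⟨hy, hz, rfl⟩
  have mul : ∀ g h, B (g * h) = B g ∘ₗ B h := by
    intro g h
    refine affine_lift_unique _ _ (fun z => by simp [hB2]) (hB2 _) _ (hB _) fun y z hy hz => ?_
    simp only [planeBlock_comp _ _ (hB2 h)]
    obtain ⟨h1, h2, h3⟩ := hB h y z hy hz
    obtain ⟨h4, h5, h6⟩ := hB g _ _ h1 h2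
    refine ⟨h4, h5, ?_⟩
    change g.1 (h.1 (scrollPoint y z hy hz)) = _
    rw [h3, h6]
    rfl
  let σ : VarAut (planeCubicThreefold k) →* Module.End k (Fin 3 → k) :=
    { toFun := B, map_one' := one, map_mul' := mul }
  let ρ : VarAut (planeCubicThreefold k) →* Module.End k (Fin 2 → k) :=
    { toFun := fun g => planeBlock (B g)
      map_one' := by rw [one, planeBlock_id]; rfl
      map_mul' := fun g h => by rw [mul, planeBlock_comp _ _ (hB2 h)]; rfl }
  refine ⟨ρ.toHomUnits, σ.toHomUnits, ?_, hB2, fun g y z hy hz => (hB g y z hy hz).2.2⟩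
  -- The lift to ℙ¹ is a block of the lift to ℙ², so σ alone determines the automorphism.
  intro g h hgh
  have hgh' : B g = B h := congrArg Units.val hgh
  refine Subtype.ext (Equiv.ext fun x => ?_)
  obtain ⟨y, z, hy, hz, rfl⟩ := exists_scrollPoint_eq x
  obtain ⟨h1, h2, h3⟩ := hB g y z hy hz
  obtain ⟨h4, h5, h6⟩ := hB h y z hy hz
  rw [h3, h6]
  simp only [hgh']

end Representations

end ClassicalVariety

namespace ClassicalVariety

/-! ### Products of projective spaces and their linear actions -/

section Segre

variable {k : Type*} [Field k] {ι κ : Type*}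

theorem segrePoint_mk {y : ι → k} {z : κ → k} (hy : y ≠ 0) (hz : z ≠ 0)
    (h : (fun ij : ι × κ => y ij.1 * z ij.2) ≠ 0) :
    segrePoint (Projectivization.mk k y hy) (Projectivization.mk k z hz) =
      Projectivization.mk k _ h := by
  obtain ⟨a, ha, hya⟩ := exists_rep_mk_eq_smul y hy
  obtain ⟨b, hb, hzb⟩ := exists_rep_mk_eq_smul z hz
  rw [segrePoint, Projectivization.mk_eq_mk_iff']
  refine ⟨a * b, funext fun ij => ?_⟩
  simp only [hya, hzb, Pi.smul_apply, smul_eq_mul]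
  ring

theorem tensor_ne_zero {y : ι → k} {z : κ → k} (hy : y ≠ 0) (hz : z ≠ 0) :
    (fun ij : ι × κ => y ij.1 * z ij.2) ≠ 0 := by
  obtain ⟨i, hi⟩ := Function.ne_iff.mp hy
  obtain ⟨j, hj⟩ := Function.ne_iff.mp hz
  exact fun h => mul_ne_zero hi hj (congrFun h (i, j))

theorem mk_mem_segre (w : ι × κ → k) (hw : w ≠ 0) : Projectivization.mk k w hw ∈ segre k ι κ ↔
    ∃ (y : ι → k) (z : κ → k), w = fun ij => y ij.1 * z ij.2 := by
  constructor
  · rintro ⟨⟨p, q⟩, h⟩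
    have h' : Projectivization.mk k w hw = segrePoint p q := h.symm
    rw [segrePoint, Projectivization.mk_eq_mk_iff'] at h'
    obtain ⟨a, rfl⟩ := h'
    exact ⟨a • p.rep, q.rep, funext fun ij => by simp [mul_assoc]⟩
  · rintro ⟨y, z, rfl⟩
    have hy : y ≠ 0 := fun h => hw (funext fun ij => by simp [h])
    have hz : z ≠ 0 := fun h => hw (funext fun ij => by simp [h])
    exact ⟨(Projectivization.mk k y hy, Projectivization.mk k z hz), segrePoint_mk hy hz hw⟩

theorem isDenseOpen_univ_diff [Infinite k] {h : MvPolynomial κ k} {e : ℕ}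
    (hh : h.IsHomogeneous e) (h0 : ∃ v, v ≠ 0 ∧ MvPolynomial.eval v h ≠ 0) :
    IsDenseOpen Set.univ (Set.univ \ hypersurface h) := by
  obtain ⟨v, hv, hv0⟩ := h0
  refine isDenseOpen_of_parametrization h hh (fun i => MvPolynomial.X i) (fun v hv => ?_) v ?_ ?_
  · simp only [Set.mem_univ, true_iff]
    exact ⟨v, by simp⟩
  · simpa using hv
  · simpa using hv0

theorem isDenseOpen_segre_diff [Infinite k] {h : MvPolynomial (ι × κ) k} {e : ℕ}
    (hh : h.IsHomogeneous e) (y : ι → k) (z : κ → k) (hy : y ≠ 0) (hz : z ≠ 0)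
    (h0 : MvPolynomial.eval (fun ij : ι × κ => y ij.1 * z ij.2) h ≠ 0) :
    IsDenseOpen (segre k ι κ) (segre k ι κ \ hypersurface h) := by
  refine isDenseOpen_of_parametrization h hh (τ := ι ⊕ κ)
    (fun ij => MvPolynomial.X (Sum.inl ij.1) * MvPolynomial.X (Sum.inr ij.2)) (fun v hv => ?_)
    (Sum.elim y z) ?_ ?_
  · rw [mk_mem_segre]
    constructor
    · rintro ⟨y, z, rfl⟩
      exact ⟨Sum.elim y z, by simp⟩
    · rintro ⟨w, rfl⟩
      exact ⟨w ∘ Sum.inl, w ∘ Sum.inr, by simp⟩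
  · simpa using tensor_ne_zero hy hz
  · simpa using h0

variable [Fintype ι] [DecidableEq ι] [Fintype κ] [DecidableEq κ] {G : Type*} [Group G]

open scoped Kronecker in
/-- The tensor product of two representations, in coordinates. -/
noncomputable def tensorRepresentation (ρ : G →* LinearMap.GeneralLinearGroup k (ι → k))
    (σ : G →* LinearMap.GeneralLinearGroup k (κ → k)) :
    G →* LinearMap.GeneralLinearGroup k (ι × κ → k) :=
  MonoidHom.toHomUnits
    { toFun := fun g => Matrix.toLin' (LinearMap.toMatrix' (ρ g : (ι → k) →ₗ[k] (ι → k)) ⊗ₖ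
        LinearMap.toMatrix' (σ g : (κ → k) →ₗ[k] (κ → k)))
      map_one' := by
        rw [map_one, map_one, Units.val_one, Units.val_one, Module.End.one_eq_id,
          Module.End.one_eq_id, LinearMap.toMatrix'_id, LinearMap.toMatrix'_id,
          Matrix.one_kronecker_one, Matrix.toLin'_one]
        rfl
      map_mul' := fun g h => by
        rw [map_mul, map_mul, Units.val_mul, Units.val_mul, LinearMap.toMatrix'_mul,
          LinearMap.toMatrix'_mul, Matrix.mul_kronecker_mul, Matrix.toLin'_mul]
        rfl }

theorem tensorRepresentation_smul (ρ : G →* LinearMap.GeneralLinearGroup k (ι → k))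
    (σ : G →* LinearMap.GeneralLinearGroup k (κ → k)) (g : G) (y : ι → k) (z : κ → k) :
    tensorRepresentation ρ σ g • (fun ij : ι × κ => y ij.1 * z ij.2) =
      fun ij => (ρ g • y) ij.1 * (σ g • z) ij.2 := by
  funext ij
  have h1 : (ρ g • y) ij.1 = ∑ i, LinearMap.toMatrix' (ρ g : (ι → k) →ₗ[k] (ι → k)) ij.1 i * y i := by
    rw [generalLinearGroup_smul_apply, ← LinearMap.toMatrix'_mulVec]
    rfl
  have h2 : (σ g • z) ij.2 = ∑ j, LinearMap.toMatrix' (σ g : (κ → k) →ₗ[k] (κ → k)) ij.2 j * z j := by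
    rw [generalLinearGroup_smul_apply, ← LinearMap.toMatrix'_mulVec]
    rfl
  rw [h1, h2, Finset.sum_mul_sum, generalLinearGroup_smul_apply]
  change ∑ l, _ = _
  rw [Fintype.sum_prod_type]
  refine Finset.sum_congr rfl fun i _ => Finset.sum_congr rfl fun j _ => ?_
  simp only [Matrix.kroneckerMap_apply]
  ring

/-- The action of a group on the product of two projectivized representations. -/
noncomputable def productAction (ρ : G →* LinearMap.GeneralLinearGroup k (ι → k))
    (σ : G →* LinearMap.GeneralLinearGroup k (κ → k)) : G →* VarAut (segre k ι κ) :=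
  linearAction (tensorRepresentation ρ σ) _ fun g p hp => by
    induction p using Projectivization.ind with
    | h w hw =>
      rw [Projectivization.smul_mk, mk_mem_segre]
      obtain ⟨y, z, rfl⟩ := (mk_mem_segre w hw).1 hp
      exact ⟨_, _, tensorRepresentation_smul ρ σ g y z⟩

theorem isProductProjectivization_productAction
    (ρ : G →* LinearMap.GeneralLinearGroup k (ι → k))
    (σ : G →* LinearMap.GeneralLinearGroup k (κ → k)) :
    IsProductProjectivization (productAction ρ σ) ρ σ := by
  intro g p q
  induction p using Projectivization.ind with
  | h y hy =>
    induction q using Projectivization.ind with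
    | h z hz =>
      rw [productAction, linearAction_apply]
      simp only [segrePoint_mk hy hz (tensor_ne_zero hy hz), Projectivization.smul_mk,
        tensorRepresentation_smul]
      rw [segrePoint_mk]

/-- The action of a group on a projectivized representation. -/
noncomputable def projectiveAction (σ : G →* LinearMap.GeneralLinearGroup k (κ → k)) :
    G →* VarAut (Set.univ : Set (ℙ k (κ → k))) :=
  linearAction σ Set.univ fun _ _ _ => Set.mem_univ _

theorem isProjectivization_projectiveAction (σ : G →* LinearMap.GeneralLinearGroup k (κ → k)) :
    IsProjectivization (projectiveAction σ) σ := fun _ _ => rfl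

theorem isDenseOpen_planeCubicThreefold_diff [IsAlgClosed k] [CharZero k]
    {h : MvPolynomial (Fin 5) k} {e : ℕ}
    (hh : h.IsHomogeneous e) (y : Fin 2 → k) (z : Fin 3 → k) (hy : y ≠ 0) (hz : z ≠ 0)
    (h0 : MvPolynomial.eval (scroll y z) h ≠ 0) :
    IsDenseOpen (planeCubicThreefold k) (planeCubicThreefold k \ hypersurface h) := by
  refine isDenseOpen_of_parametrization h hh (scrollPoly k) (fun v hv => ?_) (Sum.elim y z) ?_ ?_
  · rw [mk_mem_planeCubicThreefold]
    constructor
    · intro h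
      obtain ⟨y, z, rfl⟩ := exists_eq_scroll v h
      exact ⟨Sum.elim y z, (eval_scrollPoly y z).symm⟩
    · rintro ⟨w, rfl⟩
      rw [← Sum.elim_comp_inl_inr w, eval_scrollPoly]
      exact scroll_equation _ _
  · rw [eval_scrollPoly]
    exact scroll_ne_zero hy hz
  · rw [eval_scrollPoly]
    exact h0

end Segre

/-! ### The equivariant birational map to ℙ¹ × ℙ² and generic freeness -/

section ProductStructure

variable {k : Type*} [Field k]

/-- The form `x₃x₄`, in coordinates indexed from `0`. -/
noncomputable def lastProduct (k : Type*) [Field k] : MvPolynomial (Fin 5) k :=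
  MvPolynomial.X 3 * MvPolynomial.X 4

/-- The first component of the inverse of the parametrization `scroll`. -/
noncomputable def scrollInvFst (k : Type*) [Field k] : Fin 2 → MvPolynomial (Fin 5) k :=
  ![MvPolynomial.X 4, -MvPolynomial.X 3]

/-- The second component of the inverse of the parametrization `scroll`. -/
noncomputable def scrollInvSnd (k : Type*) [Field k] : Fin 3 → MvPolynomial (Fin 5) k :=
  ![MvPolynomial.X 0 * MvPolynomial.X 3, -(MvPolynomial.X 2 * MvPolynomial.X 4),
    MvPolynomial.X 3 * MvPolynomial.X 4]

theorem isHomogeneous_lastProduct : (lastProduct k).IsHomogeneous 2 :=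
  (MvPolynomial.isHomogeneous_X k _).mul (MvPolynomial.isHomogeneous_X k _)

theorem isHomogeneous_scrollInvFst (i : Fin 2) : (scrollInvFst k i).IsHomogeneous 1 := by
  fin_cases i
  · exact MvPolynomial.isHomogeneous_X k _
  · exact (MvPolynomial.isHomogeneous_X k _).neg

theorem isHomogeneous_scrollInvSnd (i : Fin 3) : (scrollInvSnd k i).IsHomogeneous 2 := by
  fin_cases i
  · exact (MvPolynomial.isHomogeneous_X k _).mul (MvPolynomial.isHomogeneous_X k _)
  · exact ((MvPolynomial.isHomogeneous_X k _).mul (MvPolynomial.isHomogeneous_X k _)).neg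
  · exact (MvPolynomial.isHomogeneous_X k _).mul (MvPolynomial.isHomogeneous_X k _)

theorem eval_lastProduct_scroll (y : Fin 2 → k) (z : Fin 3 → k) :
    MvPolynomial.eval (scroll y z) (lastProduct k) = -(y 0 * y 1 * z 2 ^ 2) := by
  simp [lastProduct, scroll]
  ring

theorem eval_scrollInvFst_scroll (y : Fin 2 → k) (z : Fin 3 → k) :
    (fun i => MvPolynomial.eval (scroll y z) (scrollInvFst k i)) = z 2 • y := by
  funext i
  fin_cases i <;> simp [scrollInvFst, scroll, mul_comm]

theorem eval_scrollInvSnd_scroll (y : Fin 2 → k) (z : Fin 3 → k) :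
    (fun i => MvPolynomial.eval (scroll y z) (scrollInvSnd k i)) =
      (-(y 0 * y 1 * z 2)) • z := by
  funext i
  fin_cases i <;> simp [scrollInvSnd, scroll] <;> ring

/-- The linear projection of the Segre threefold onto the cubic threefold. -/
noncomputable def segreProjection (k : Type*) [Field k] :
    Fin 5 → MvPolynomial (Fin 2 × Fin 3) k :=
  ![MvPolynomial.X (0, 0), MvPolynomial.X (0, 1) + MvPolynomial.X (1, 0), MvPolynomial.X (1, 1),
    -MvPolynomial.X (1, 2), MvPolynomial.X (0, 2)]

theorem isHomogeneous_segreProjection (i : Fin 5) : (segreProjection k i).IsHomogeneous 1 := by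
  fin_cases i
  · exact MvPolynomial.isHomogeneous_X k _
  · exact (MvPolynomial.isHomogeneous_X k _).add (MvPolynomial.isHomogeneous_X k _)
  · exact MvPolynomial.isHomogeneous_X k _
  · exact (MvPolynomial.isHomogeneous_X k _).neg
  · exact MvPolynomial.isHomogeneous_X k _

theorem eval_segreProjection (y : Fin 2 → k) (z : Fin 3 → k) :
    (fun i => MvPolynomial.eval (fun ij : Fin 2 × Fin 3 => y ij.1 * z ij.2)
      (segreProjection k i)) = scroll y z := by
  funext i
  fin_cases i <;> simp [segreProjection, scroll]

theorem ne_zero_of_eval_lastProduct {y : Fin 2 → k} {z : Fin 3 → k}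
    (h : MvPolynomial.eval (scroll y z) (lastProduct k) ≠ 0) :
    y 0 ≠ 0 ∧ y 1 ≠ 0 ∧ z 2 ≠ 0 ∧ y ≠ 0 ∧ z ≠ 0 := by
  rw [eval_lastProduct_scroll] at h
  have h0 : y 0 ≠ 0 := fun h0 => h (by simp [h0])
  have h1 : y 1 ≠ 0 := fun h0 => h (by simp [h0])
  have h2 : z 2 ≠ 0 := fun h0 => h (by simp [h0])
  exact ⟨h0, h1, h2, fun h => h0 (congrFun h 0), fun h => h2 (congrFun h 2)⟩

/-- A group acting on the cubic threefold through linear actions on its parametrization acts in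
the same way on a product of projective spaces. -/
theorem equivariantlyBirational_productAction [IsAlgClosed k] [CharZero k] {G : Type*} [Group G]
    (a : G →* VarAut (planeCubicThreefold k))
    (ρ : G →* LinearMap.GeneralLinearGroup k (Fin 2 → k))
    (σ : G →* LinearMap.GeneralLinearGroup k (Fin 3 → k))
    (h : ∀ g y z hy hz, (a g).1 (scrollPoint y z hy hz) = scrollPoint (ρ g • y) (σ g • z)
        ((smul_ne_zero_iff_ne _).mpr hy) ((smul_ne_zero_iff_ne _).mpr hz)) :
    EquivariantlyBirational a (productAction ρ σ) := by
  obtain ⟨y₁, z₁, e0⟩ : ∃ y z, MvPolynomial.eval (scroll y z) (lastProduct k) ≠ 0 :=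
    ⟨fun _ => 1, fun _ => 1, by simp [eval_lastProduct_scroll]⟩
  obtain ⟨-, -, -, e2, e3⟩ := ne_zero_of_eval_lastProduct e0
  -- The inverse forms recover the tensor of `y` and `z` up to a scalar, which is nonzero exactly
  -- where the form `lastProduct` is.
  have evF : ∀ y z, (fun ij : Fin 2 × Fin 3 => MvPolynomial.eval (scroll y z)
      (scrollInvFst k ij.1 * scrollInvSnd k ij.2)) =
      (z 2 * (-(y 0 * y 1 * z 2))) • fun ij => y ij.1 * z ij.2 := by
    intro y z
    funext ij
    have h1 := congrFun (eval_scrollInvFst_scroll y z) ij.1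
    have h2 := congrFun (eval_scrollInvSnd_scroll y z) ij.2
    simp only [map_mul, Pi.smul_apply, smul_eq_mul] at h1 h2 ⊢
    rw [h1, h2]
    ring
  refine equivariantlyBirational_of_forms a _ (lastProduct k) isHomogeneous_lastProduct
    (fun ij => scrollInvFst k ij.1 * scrollInvSnd k ij.2) (segreProjection k)
    (fun ij => (isHomogeneous_scrollInvFst _).mul (isHomogeneous_scrollInvSnd _))
    isHomogeneous_segreProjection
    (isDenseOpen_planeCubicThreefold_diff isHomogeneous_lastProduct _ _ e2 e3 e0)
    (isDenseOpen_segre_diff (isHomogeneous_lastProduct.aeval _ isHomogeneous_segreProjection)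
      _ _ e2 e3 (by rw [eval_aeval, eval_segreProjection]; exact e0))
    ?_ ?_ (tensorRepresentation ρ σ) (fun g p => rfl) ?_
  · intro v hv hX hne
    obtain ⟨y, z, rfl⟩ := exists_eq_scroll v ((mk_mem_planeCubicThreefold v hv).1 hX)
    obtain ⟨h0, h1, h2, hy, hz⟩ := ne_zero_of_eval_lastProduct hne
    have hc : z 2 * (-(y 0 * y 1 * z 2)) ≠ 0 := by simp [h0, h1, h2]
    simp only [evF]
    refine ⟨smul_ne_zero hc (tensor_ne_zero hy hz), ?_, _, hc, ?_⟩
    · rw [mk_mem_segre]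
      exact ⟨_, z, funext fun ij => by rw [Pi.smul_apply, smul_eq_mul, ← mul_assoc,
        ← smul_eq_mul (a := z 2 * (-(y 0 * y 1 * z 2))), ← Pi.smul_apply]⟩
    · rw [← eval_segreProjection y z]
      funext i
      rw [eval_smul_of_isHomogeneous (isHomogeneous_segreProjection i), pow_one]
      rfl
  · intro w hw hY hne
    obtain ⟨y, z, rfl⟩ := (mk_mem_segre w hw).1 hY
    simp only [eval_segreProjection] at hne ⊢
    obtain ⟨h0, h1, h2, hy, hz⟩ := ne_zero_of_eval_lastProduct hne
    exact ⟨scroll_ne_zero hy hz, (mk_mem_planeCubicThreefold _ _).2 (scroll_equation y z), _,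
      evF y z⟩
  · intro g w hw hY hne
    obtain ⟨y, z, rfl⟩ := (mk_mem_segre w hw).1 hY
    simp only [eval_segreProjection, tensorRepresentation_smul] at hne ⊢
    obtain ⟨h0, h1, h2, hy, hz⟩ := ne_zero_of_eval_lastProduct hne
    intro _ _
    exact ⟨scroll_ne_zero ((smul_ne_zero_iff_ne _).mpr hy) ((smul_ne_zero_iff_ne _).mpr hz),
      congrArg Subtype.val (h g y z hy hz)⟩

/-- A form that does not vanish identically but vanishes on the points with nontrivial
stabilizer. -/
theorem exists_form_vanishing_on_fixed_points {G : Type*} [Group G] [Finite G] [Infinite k]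
    (σ : G →* LinearMap.GeneralLinearGroup k (Fin 3 → k)) (hσ : Function.Injective σ) :
    ∃ (h : MvPolynomial (Fin 3) k) (e : ℕ), h.IsHomogeneous e ∧
      (∃ v, v ≠ 0 ∧ MvPolynomial.eval v h ≠ 0) ∧
      ∀ v, MvPolynomial.eval v h ≠ 0 → v 2 ≠ 0 ∧ ∀ g, σ g • v = v → g = 1 := by
  classical
  have := Fintype.ofFinite G
  have hex : ∀ g : G, g ≠ 1 → ∃ i v, (σ g • v : Fin 3 → k) i ≠ v i := by
    intro g hg
    by_contra! hc
    refine hg (hσ (Units.ext (LinearMap.ext fun v => ?_)))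
    rw [map_one]
    exact funext fun i => hc i v
  choose! i v hiv using hex
  let A : G → (Fin 3 → k) →ₗ[k] (Fin 3 → k) := fun g => (σ g : (Fin 3 → k) →ₗ[k] _) - LinearMap.id
  -- For g ≠ 1 faithfulness gives a coordinate of σ g - 1 that is a nonzero linear form; it vanishes
  -- on the vectors fixed by g.
  let h : MvPolynomial (Fin 3) k := MvPolynomial.X 2 *
    ∏ g ∈ Finset.univ.filter (fun g : G => g ≠ 1), linearForms (A g) (i g)
  have h0 : h ≠ 0 := by
    refine mul_ne_zero (MvPolynomial.X_ne_zero _) (Finset.prod_ne_zero_iff.mpr fun g hg h0 => ?_)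
    refine hiv g (Finset.mem_filter.mp hg).2 ?_
    have := congrArg (MvPolynomial.eval (v g)) h0
    rw [eval_linearForms, map_zero] at this
    exact sub_eq_zero.mp this
  have key : ∀ v, MvPolynomial.eval v h ≠ 0 → v 2 ≠ 0 ∧ ∀ g, σ g • v = v → g = 1 := by
    intro v hv
    rw [map_mul, MvPolynomial.eval_X, map_prod] at hv
    refine ⟨left_ne_zero_of_mul hv, fun g hg => ?_⟩
    by_contra hg1
    refine Finset.prod_ne_zero_iff.mp (right_ne_zero_of_mul hv) g (by simp [hg1]) ?_
    rw [eval_linearForms]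
    exact sub_eq_zero.mpr (congrFun hg (i g))
  obtain ⟨v, hv⟩ : ∃ v, MvPolynomial.eval v h ≠ 0 := by
    by_contra! hc
    exact h0 (MvPolynomial.funext fun v => by rw [hc, map_zero])
  exact ⟨h, _, (MvPolynomial.isHomogeneous_X k _).mul (MvPolynomial.IsHomogeneous.prod _ _ _
    fun g _ => isHomogeneous_linearForms (A g) (i g)),
    ⟨v, fun h1 => (key v hv).1 (congrFun h1 2), hv⟩, key⟩

/-- Invariance of z₂ forces the scalar by which a stabilizing element acts on a vector with z₂ ≠ 0
to be 1, so the stabilizer of the point is that of the vector. -/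
theorem isGenericallyFree_projectiveAction {G : Type*} [Group G] [Finite G] [Infinite k]
    (σ : G →* LinearMap.GeneralLinearGroup k (Fin 3 → k)) (hσ : Function.Injective σ)
    (h2 : ∀ g (z : Fin 3 → k), (σ g • z) 2 = z 2) : IsGenericallyFree (projectiveAction σ) := by
  obtain ⟨h, e, hh, hne, key⟩ := exists_form_vanishing_on_fixed_points σ hσ
  refine ⟨_, isDenseOpen_univ_diff hh hne, ?_⟩
  rintro ⟨p, hp⟩ ⟨-, hpU⟩ g hg
  induction p using Projectivization.ind with
  | h v hv =>
    obtain ⟨hv2, hfix⟩ := key v fun h0 => hpU ((mk_mem_hypersurface hh v hv).2 h0)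
    have h3 := congrArg Subtype.val hg
    rw [isProjectivization_projectiveAction, Projectivization.smul_mk,
      Projectivization.mk_eq_mk_iff'] at h3
    obtain ⟨a, ha⟩ := h3
    have h4 := congrFun ha 2
    rw [h2, Pi.smul_apply, smul_eq_mul] at h4
    have ha1 : a = 1 := mul_right_cancel₀ hv2 (by rw [h4, one_mul])
    rw [ha1, one_smul] at ha
    exact hfix g ha.symm

end ProductStructure

end ClassicalVariety

namespace ClassicalVariety

/-! ### Linearization by an equivariant frame -/

section Linearization

variable {k : Type*} [Field k]

/-- A frame of equivariant maps from the plane to a representation of rank two. -/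
theorem exists_equivariant_frame {G : Type*} [Group G] [Finite G] [Infinite k]
    (ρ : G →* LinearMap.GeneralLinearGroup k (Fin 2 → k))
    (σ : G →* LinearMap.GeneralLinearGroup k (Fin 3 → k)) (hσ : Function.Injective σ)
    (h2 : ∀ g (z : Fin 3 → k), (σ g • z) 2 = z 2) :
    ∃ (E : Fin 2 → Fin 2 → MvPolynomial (Fin 3) k) (d : ℕ), (∀ i j, (E i j).IsHomogeneous d) ∧
      (∀ g i (w : Fin 3 → k), (fun j => MvPolynomial.eval (σ g • w) (E i j)) =
        ρ g • fun j => MvPolynomial.eval w (E i j)) ∧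
      ∃ w : Fin 3 → k, w 2 ≠ 0 ∧ ∃ s : k, s ≠ 0 ∧
        ∀ i, (fun j => MvPolynomial.eval w (E i j)) = s • Pi.single i 1 := by
  classical
  have := Fintype.ofFinite G
  obtain ⟨h, -, -, ⟨w, -, hw⟩, hfix⟩ := exists_form_vanishing_on_fixed_points σ hσ
  obtain ⟨hw2, hfix⟩ := hfix w hw
  have hex : ∀ g : G, g ≠ 1 → ∃ i, (σ g • w : Fin 3 → k) i ≠ w i := by
    intro g hg
    by_contra! hc
    exact hg (hfix g (funext hc))
  choose! i hi using hex
  -- A linear form that vanishes at σ g • w but not at w; it exists because the two vectors agree in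
  -- the last coordinate and differ in another.
  let L : G → MvPolynomial (Fin 3) k := fun g =>
    MvPolynomial.C (w 2) * MvPolynomial.X (i g) -
      MvPolynomial.C ((σ g • w : Fin 3 → k) (i g)) * MvPolynomial.X 2
  have hL : ∀ g v, MvPolynomial.eval v (L g) = w 2 * v (i g) - (σ g • w : Fin 3 → k) (i g) * v 2 :=
    fun g v => by simp [L]
  let φ : MvPolynomial (Fin 3) k := ∏ g ∈ Finset.univ.filter (fun g : G => g ≠ 1), L g
  have hφ : φ.IsHomogeneous (∑ g ∈ Finset.univ.filter (fun g : G => g ≠ 1), 1) :=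
    MvPolynomial.IsHomogeneous.prod _ _ _ fun g _ =>
      (MvPolynomial.isHomogeneous_C_mul_X _ _).sub (MvPolynomial.isHomogeneous_C_mul_X _ _)
  have hφ0 : MvPolynomial.eval w φ ≠ 0 := by
    rw [map_prod]
    refine Finset.prod_ne_zero_iff.mpr fun g hg => ?_
    rw [hL, mul_comm _ (w 2), ← mul_sub]
    exact mul_ne_zero hw2 (sub_ne_zero.mpr (hi g (Finset.mem_filter.mp hg).2).symm)
  have hφ1 : ∀ g, g ≠ 1 → MvPolynomial.eval (σ g • w) φ = 0 := by
    intro g hg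
    rw [map_prod]
    refine Finset.prod_eq_zero (i := g) (by simp [hg]) ?_
    rw [hL, h2]
    ring
  -- The average of φ(σ(g)v) ρ(g)⁻¹ e_l over G. It is equivariant by reindexing, and at `w` only the
  -- term of g = 1 survives, so there the frame is a multiple of the standard basis.
  let E : Fin 2 → Fin 2 → MvPolynomial (Fin 3) k := fun l j => ∑ g : G,
    MvPolynomial.C ((ρ g⁻¹ • (Pi.single l 1 : Fin 2 → k)) j) *
      MvPolynomial.aeval (linearForms (σ g : (Fin 3 → k) →ₗ[k] (Fin 3 → k))) φ
  have hE : ∀ l (v : Fin 3 → k), (fun j => MvPolynomial.eval v (E l j)) =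
      ∑ g : G, MvPolynomial.eval (σ g • v) φ • ρ g⁻¹ • (Pi.single l 1 : Fin 2 → k) := by
    intro l v
    funext j
    rw [map_sum, Finset.sum_apply]
    refine Finset.sum_congr rfl fun g _ => ?_
    rw [map_mul, MvPolynomial.eval_C, eval_aeval, Pi.smul_apply, smul_eq_mul, mul_comm]
    congr 3
    funext m
    rw [eval_linearForms]
    rfl
  refine ⟨E, 1 * ∑ g ∈ Finset.univ.filter (fun g : G => g ≠ 1), 1,
    fun l j => MvPolynomial.IsHomogeneous.sum _ _ _ fun g _ => ?_, ?_, w, hw2, _, hφ0, ?_⟩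
  · exact (hφ.aeval _ (isHomogeneous_linearForms _)).C_mul _
  · intro γ l v
    rw [hE, hE, Finset.smul_sum]
    refine Fintype.sum_equiv (Equiv.mulRight γ) _ _ fun g => ?_
    rw [smul_comm (ρ γ), Equiv.coe_mulRight, smul_smul (σ g), smul_smul (ρ γ), ← map_mul,
      ← map_mul]
    simp
  · intro l
    rw [hE, Finset.sum_eq_single 1]
    · simp
    · intro g _ hg
      rw [hφ1 g hg, zero_smul]
    · simp

/-- The determinant of two plane vectors. -/
def planeDet {R : Type*} [CommRing R] (u v : Fin 2 → R) : R := u 0 * v 1 - u 1 * v 0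

theorem map_planeDet {R S : Type*} [CommRing R] [CommRing S] (f : R →+* S) (u v : Fin 2 → R) :
    f (planeDet u v) = planeDet (fun i => f (u i)) fun i => f (v i) := by
  simp [planeDet]

theorem planeDet_smul_left {R : Type*} [CommRing R] (c : R) (u v : Fin 2 → R) :
    planeDet (c • u) v = c * planeDet u v := by
  simp [planeDet]
  ring

theorem planeDet_smul_right {R : Type*} [CommRing R] (c : R) (u v : Fin 2 → R) :
    planeDet u (c • v) = c * planeDet u v := by
  simp [planeDet]
  ring

theorem isHomogeneous_planeDet {ι : Type*} {u v : Fin 2 → MvPolynomial ι k} {d e : ℕ}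
    (hu : ∀ i, (u i).IsHomogeneous d) (hv : ∀ i, (v i).IsHomogeneous e) :
    (planeDet u v).IsHomogeneous (d + e) :=
  ((hu 0).mul (hv 1)).sub ((hu 1).mul (hv 0))

/-- The sum of a representation and the trivial representation of rank one. -/
noncomputable def consRepresentation {n : ℕ} {G : Type*} [Group G]
    (σ : G →* LinearMap.GeneralLinearGroup k (Fin n → k)) :
    G →* LinearMap.GeneralLinearGroup k (Fin (n + 1) → k) :=
  MonoidHom.toHomUnits
    { toFun := fun g =>
        { toFun := fun q => Fin.cons (q 0) (σ g • fun i : Fin n => q i.succ)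
          map_add' := fun q q' => by
            funext i
            refine Fin.cases ?_ (fun i => ?_) i
            · simp
            · exact congrFun (smul_add (σ g) (fun i : Fin n => q i.succ) fun i => q' i.succ) i
          map_smul' := fun a q => by
            funext i
            refine Fin.cases ?_ (fun i => ?_) i
            · simp
            · exact congrFun (smul_comm (σ g) a fun i : Fin n => q i.succ) i }
      map_one' := LinearMap.ext fun q => by
        funext i
        refine Fin.cases ?_ (fun i => ?_) i <;> simp
      map_mul' := fun g h => LinearMap.ext fun q => by
        funext i
        refine Fin.cases ?_ (fun i => ?_) i <;> simp [mul_smul] }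

theorem consRepresentation_smul {n : ℕ} {G : Type*} [Group G]
    (σ : G →* LinearMap.GeneralLinearGroup k (Fin n → k)) (g : G) (t : k) (w : Fin n → k) :
    consRepresentation σ g • (Fin.cons t w : Fin (n + 1) → k) = Fin.cons t (σ g • w) := rfl

/-- The rational map from a projective space to the cubic threefold defined by a frame. -/
noncomputable def frameMap (E : Fin 2 → Fin 2 → MvPolynomial (Fin 3) k) :
    Fin 5 → MvPolynomial (Fin 4) k :=
  scroll (fun j => MvPolynomial.X 0 * MvPolynomial.rename Fin.succ (E 0 j) +
    MvPolynomial.X 3 * MvPolynomial.rename Fin.succ (E 1 j)) fun j => MvPolynomial.X j.succ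

/-- The inverse of `frameMap`. -/
noncomputable def frameMapInv (E : Fin 2 → Fin 2 → MvPolynomial (Fin 3) k) :
    Fin 4 → MvPolynomial (Fin 5) k :=
  Fin.cons (scrollInvSnd k 2 *
      planeDet (scrollInvFst k) fun j => MvPolynomial.aeval (scrollInvSnd k) (E 1 j))
    fun i => planeDet (fun j => MvPolynomial.aeval (scrollInvSnd k) (E 0 j)) (scrollInvFst k) *
      scrollInvSnd k i

/-- A form such that `frameMap` is an isomorphism onto the set where it does not vanish. -/
noncomputable def frameDenominator (E : Fin 2 → Fin 2 → MvPolynomial (Fin 3) k) :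
    MvPolynomial (Fin 5) k :=
  lastProduct k * (MvPolynomial.aeval (scrollInvSnd k) (planeDet (E 0) (E 1)) *
    planeDet (fun j => MvPolynomial.aeval (scrollInvSnd k) (E 0 j)) (scrollInvFst k))

theorem isHomogeneous_scroll {ι : Type*} {y : Fin 2 → MvPolynomial ι k}
    {z : Fin 3 → MvPolynomial ι k} {d e : ℕ} (hy : ∀ i, (y i).IsHomogeneous d)
    (hz : ∀ i, (z i).IsHomogeneous e) (i : Fin 5) : (scroll y z i).IsHomogeneous (d + e) := by
  fin_cases i
  · exact (hy 0).mul (hz 0)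
  · exact ((hy 0).mul (hz 1)).add ((hy 1).mul (hz 0))
  · exact (hy 1).mul (hz 1)
  · exact ((hy 1).mul (hz 2)).neg
  · exact (hy 0).mul (hz 2)

section Frame

variable (E : Fin 2 → Fin 2 → MvPolynomial (Fin 3) k) {d : ℕ}

/-- The coefficient of the second frame vector is the invariant coordinate w₂: it keeps the
expression homogeneous in (t, w) without spoiling equivariance. -/
theorem eval_frameMap (t : k) (w : Fin 3 → k) :
    (fun i => MvPolynomial.eval (Fin.cons t w : Fin 4 → k) (frameMap E i)) =
      scroll (t • (fun j => MvPolynomial.eval w (E 0 j)) +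
        w 2 • fun j => MvPolynomial.eval w (E 1 j)) w := by
  funext i
  rw [frameMap, map_scroll]
  congr 1
  · funext j
    have h3 : (Fin.cons t w : Fin 4 → k) 3 = w 2 := rfl
    simp [MvPolynomial.eval_rename, h3, Fin.cons_comp_succ]
  · funext j
    simp

variable {E} (hE : ∀ i j, (E i j).IsHomogeneous d)

include hE

theorem isHomogeneous_frameMap (i : Fin 5) : (frameMap E i).IsHomogeneous (1 + d + 1) :=
  isHomogeneous_scroll (fun j =>
    ((MvPolynomial.isHomogeneous_X k _).mul (hE 0 j).rename_isHomogeneous).add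
      ((MvPolynomial.isHomogeneous_X k _).mul (hE 1 j).rename_isHomogeneous))
    (fun _ => MvPolynomial.isHomogeneous_X k _) i

theorem isHomogeneous_frameMapInv (i : Fin 4) :
    (frameMapInv E i).IsHomogeneous (2 * d + 1 + 2) := by
  refine Fin.cases ?_ (fun i => ?_) i
  · have := (isHomogeneous_scrollInvSnd (k := k) 2).mul (isHomogeneous_planeDet
      (isHomogeneous_scrollInvFst (k := k))
      fun j => (hE 1 j).aeval _ (isHomogeneous_scrollInvSnd (k := k)))
    rw [show 2 * d + 1 + 2 = 2 + (1 + 2 * d) by ring]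
    exact this
  · exact (isHomogeneous_planeDet (fun j => (hE 0 j).aeval _ (isHomogeneous_scrollInvSnd (k := k)))
      (isHomogeneous_scrollInvFst (k := k))).mul (isHomogeneous_scrollInvSnd (k := k) i)

theorem isHomogeneous_frameDenominator :
    (frameDenominator E).IsHomogeneous (2 + (2 * (d + d) + (2 * d + 1))) :=
  isHomogeneous_lastProduct.mul (((isHomogeneous_planeDet (hE 0) (hE 1)).aeval _
    isHomogeneous_scrollInvSnd).mul (isHomogeneous_planeDet
      (fun j => (hE 0 j).aeval _ isHomogeneous_scrollInvSnd) isHomogeneous_scrollInvFst))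

theorem eval_frame_scroll (i : Fin 2) (y : Fin 2 → k) (z : Fin 3 → k) :
    (fun j => MvPolynomial.eval (scroll y z) (MvPolynomial.aeval (scrollInvSnd k) (E i j))) =
      (-(y 0 * y 1 * z 2)) ^ d • fun j => MvPolynomial.eval z (E i j) := by
  funext j
  rw [eval_aeval, eval_scrollInvSnd_scroll, eval_smul_of_isHomogeneous (hE i j)]
  rfl

/-- This is Cramer's rule: the coordinates of `y` in the frame (e₀, e₁) at `z` have ratio det(y, e₁)
: det(e₀, y). The vector is scaled so that this ratio becomes t : w₂. -/
theorem eval_frameMapInv (y : Fin 2 → k) (z : Fin 3 → k) :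
    (fun i => MvPolynomial.eval (scroll y z) (frameMapInv E i)) =
      ((-(y 0 * y 1 * z 2)) ^ (d + 1) * z 2) •
        (Fin.cons (z 2 * planeDet y fun j => MvPolynomial.eval z (E 1 j))
          (planeDet (fun j => MvPolynomial.eval z (E 0 j)) y • z) : Fin 4 → k) := by
  have hs : ∀ i, MvPolynomial.eval (scroll y z) (scrollInvSnd k i) = -(y 0 * y 1 * z 2) * z i :=
    fun i => congrFun (eval_scrollInvSnd_scroll y z) i
  funext i
  refine Fin.cases ?_ (fun i => ?_) i
  · simp only [frameMapInv, Fin.cons_zero, map_mul, map_planeDet, eval_frame_scroll hE,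
      eval_scrollInvFst_scroll, hs, planeDet_smul_left, planeDet_smul_right, Pi.smul_apply,
      smul_eq_mul]
    ring
  · simp only [frameMapInv, Fin.cons_succ, map_mul, map_planeDet, eval_frame_scroll hE,
      eval_scrollInvFst_scroll, hs, planeDet_smul_left, planeDet_smul_right, Pi.smul_apply,
      smul_eq_mul]
    ring

/-- The factors ensure in turn that `scroll` can be inverted, that the frame is independent at `z`,
and that `y` is not a multiple of the first frame vector. -/
theorem eval_frameDenominator (y : Fin 2 → k) (z : Fin 3 → k) :
    MvPolynomial.eval (scroll y z) (frameDenominator E) =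
      MvPolynomial.eval (scroll y z) (lastProduct k) *
      ((-(y 0 * y 1 * z 2)) ^ (3 * d) * z 2 * (planeDet (fun j => MvPolynomial.eval z (E 0 j))
        (fun j => MvPolynomial.eval z (E 1 j)) *
        planeDet (fun j => MvPolynomial.eval z (E 0 j)) y)) := by
  have h := fun i => eval_frame_scroll hE i y z
  rw [frameDenominator, map_mul, map_mul, map_planeDet, eval_scrollInvFst_scroll, h,
    show MvPolynomial.aeval (scrollInvSnd k) (planeDet (E 0) (E 1)) = planeDet
      (fun j => MvPolynomial.aeval (scrollInvSnd k) (E 0 j))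
      (fun j => MvPolynomial.aeval (scrollInvSnd k) (E 1 j)) from
      by simp only [planeDet, map_sub, map_mul], map_planeDet, h, h]
  simp only [planeDet_smul_left, planeDet_smul_right]
  ring

end Frame

/-- A finite group acting on the cubic threefold through linear actions on its parametrization
acts linearizably. -/
theorem isLinearizable_of_finite [IsAlgClosed k] [CharZero k] {G : Type*} [Group G] [Finite G]
    (a : G →* VarAut (planeCubicThreefold k))
    (ρ : G →* LinearMap.GeneralLinearGroup k (Fin 2 → k))
    (σ : G →* LinearMap.GeneralLinearGroup k (Fin 3 → k)) (hσ : Function.Injective σ)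
    (h2 : ∀ g (z : Fin 3 → k), (σ g • z) 2 = z 2)
    (h : ∀ g y z hy hz, (a g).1 (scrollPoint y z hy hz) = scrollPoint (ρ g • y) (σ g • z)
        ((smul_ne_zero_iff_ne _).mpr hy) ((smul_ne_zero_iff_ne _).mpr hz)) :
    IsLinearizable 3 a := by
  obtain ⟨E, d, hE, heq, w₀, hw₀, s, hs, hframe⟩ := exists_equivariant_frame ρ σ hσ h2
  have hne : ∀ y z, MvPolynomial.eval (scroll y z) (frameDenominator E) ≠ 0 →
      MvPolynomial.eval (scroll y z) (lastProduct k) ≠ 0 ∧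
      planeDet (fun j => MvPolynomial.eval z (E 0 j)) (fun j => MvPolynomial.eval z (E 1 j)) ≠ 0 ∧
      planeDet (fun j => MvPolynomial.eval z (E 0 j)) y ≠ 0 := by
    intro y z h0
    rw [eval_frameDenominator hE] at h0
    have h1 := right_ne_zero_of_mul (right_ne_zero_of_mul h0)
    exact ⟨left_ne_zero_of_mul h0, left_ne_zero_of_mul h1, right_ne_zero_of_mul h1⟩
  have hbase : ∀ r : k, r ≠ 0 →
      MvPolynomial.eval (scroll (fun _ => r) w₀) (frameDenominator E) ≠ 0 := by
    intro r hr
    rw [eval_frameDenominator hE, eval_lastProduct_scroll, hframe, hframe]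
    simp [planeDet, hr, hs, hw₀]
  have hw : w₀ ≠ 0 := fun h0 => hw₀ (congrFun h0 2)
  -- At the base point the frame is s times the standard basis, so t = w₂ gives a vector `y` with
  -- equal nonzero coordinates, where the denominator does not vanish.
  have hbase' : (fun i => MvPolynomial.eval (Fin.cons (w₀ 2) w₀ : Fin 4 → k) (frameMap E i)) =
      scroll (fun _ => w₀ 2 * s) w₀ := by
    rw [eval_frameMap, hframe, hframe]
    congr 1
    funext i
    fin_cases i <;> simp
  refine ⟨consRepresentation σ, projectiveAction _, isProjectivization_projectiveAction _, ?_⟩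
  refine equivariantlyBirational_of_forms a _ (frameDenominator E)
    (isHomogeneous_frameDenominator hE) (frameMapInv E) (frameMap E)
    (isHomogeneous_frameMapInv hE) (isHomogeneous_frameMap hE)
    (isDenseOpen_planeCubicThreefold_diff (isHomogeneous_frameDenominator hE) _ w₀
      (fun h0 => one_ne_zero (congrFun h0 0)) hw (hbase 1 one_ne_zero))
    (isDenseOpen_univ_diff ((isHomogeneous_frameDenominator hE).aeval _
      (isHomogeneous_frameMap hE)) ⟨Fin.cons (w₀ 2) w₀, fun h0 => hw₀ (congrFun h0 0), ?_⟩)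
    ?_ ?_ (consRepresentation σ) (isProjectivization_projectiveAction _) ?_
  · rw [eval_aeval, hbase']
    exact hbase _ (mul_ne_zero hw₀ hs)
  · intro v hv hX h0
    obtain ⟨y, z, rfl⟩ := exists_eq_scroll v ((mk_mem_planeCubicThreefold v hv).1 hX)
    obtain ⟨h1, h3, h4⟩ := hne y z h0
    obtain ⟨hy0, hy1, hz2, hy, hz⟩ := ne_zero_of_eval_lastProduct h1
    have hc : (-(y 0 * y 1 * z 2)) ^ (d + 1) * z 2 ≠ 0 := by simp [hy0, hy1, hz2]
    rw [eval_frameMapInv hE]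
    refine ⟨smul_ne_zero hc fun h5 => smul_ne_zero h4 hz (funext fun i => congrFun h5 i.succ),
      Set.mem_univ _, ?_⟩
    set b := planeDet (fun j => MvPolynomial.eval z (E 0 j)) y with hb
    have hE' : ∀ i, (fun j => MvPolynomial.eval (b • z) (E i j)) =
        b ^ d • fun j => MvPolynomial.eval z (E i j) := fun i => funext fun j =>
      eval_smul_of_isHomogeneous (hE i j) b z
    have hfinal : (fun i => MvPolynomial.eval (Fin.cons
        (z 2 * planeDet y fun j => MvPolynomial.eval z (E 1 j)) (b • z) : Fin 4 → k)
        (frameMap E i)) = (b ^ d * z 2 * planeDet (fun j => MvPolynomial.eval z (E 0 j))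
          (fun j => MvPolynomial.eval z (E 1 j)) * b) • scroll y z := by
      rw [eval_frameMap, hE', hE', ← scroll_smul]
      congr 1
      funext i
      fin_cases i <;> simp [planeDet, hb] <;> ring
    refine ⟨_, mul_ne_zero (pow_ne_zero (1 + d + 1) hc) (mul_ne_zero (mul_ne_zero (mul_ne_zero
      (pow_ne_zero d h4) hz2) h3) h4), ?_⟩
    refine Eq.trans ?_ (smul_smul _ _ _)
    rw [← hfinal]
    funext i
    rw [eval_smul_of_isHomogeneous (isHomogeneous_frameMap hE i)]
    rfl
  · intro q hq _ h0
    obtain ⟨t, w, rfl⟩ : ∃ (t : k) (w : Fin 3 → k), q = Fin.cons t w :=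
      ⟨q 0, Fin.tail q, (Fin.cons_self_tail q).symm⟩
    rw [eval_frameMap] at h0 ⊢
    obtain ⟨h1, h3, h4⟩ := hne _ _ h0
    obtain ⟨hy0, hy1, hz2, hy, hz⟩ := ne_zero_of_eval_lastProduct h1
    refine ⟨scroll_ne_zero hy hz, (mk_mem_planeCubicThreefold _ _).2 (scroll_equation _ _), ?_⟩
    rw [eval_frameMapInv hE]
    set u := (fun j => MvPolynomial.eval w (E 0 j)) with hu
    set v := (fun j => MvPolynomial.eval w (E 1 j)) with hv
    have : (Fin.cons (w 2 * planeDet (t • u + w 2 • v) v) (planeDet u (t • u + w 2 • v) • w) :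
        Fin 4 → k) = (w 2 * planeDet u v) • (Fin.cons t w : Fin 4 → k) := by
      funext i
      refine Fin.cases ?_ (fun i => ?_) i
      · simp [planeDet]
        ring
      · simp [planeDet]
        left
        ring
    rw [this, smul_smul]
    exact ⟨_, rfl⟩
  · intro g q hq _ h0
    obtain ⟨t, w, rfl⟩ : ∃ (t : k) (w : Fin 3 → k), q = Fin.cons t w :=
      ⟨q 0, Fin.tail q, (Fin.cons_self_tail q).symm⟩
    -- Equivariance of the frame and invariance of `t` and w₂ make `y` transform by ρ.
    have hy' : t • (fun j => MvPolynomial.eval (σ g • w) (E 0 j)) +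
        (σ g • w) 2 • (fun j => MvPolynomial.eval (σ g • w) (E 1 j)) =
        ρ g • (t • (fun j => MvPolynomial.eval w (E 0 j)) +
          w 2 • fun j => MvPolynomial.eval w (E 1 j)) := by
      rw [heq, heq, h2, smul_add, smul_comm t, smul_comm (w 2)]
    rw [eval_frameMap] at h0
    simp only [consRepresentation_smul, eval_frameMap, hy']
    obtain ⟨h1, h3, h4⟩ := hne _ _ h0
    obtain ⟨hy0, hy1, hz2, hy, hz⟩ := ne_zero_of_eval_lastProduct h1
    intro _ _
    exact ⟨scroll_ne_zero ((smul_ne_zero_iff_ne _).mpr hy) ((smul_ne_zero_iff_ne _).mpr hz),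
      congrArg Subtype.val (h g _ w hy hz)⟩

end Linearization

end ClassicalVariety

namespace ClassicalVariety

/-! ### Cubics singular along a plane -/

section PlaneSingular

variable {k : Type*} [Field k]

/-- Coordinates adapted to a three-dimensional subspace. -/
theorem exists_linearEquiv_mem_of_finrank_eq_three (W : Submodule k (Fin 5 → k))
    (hW : Module.finrank k W = 3) :
    ∃ A : (Fin 5 → k) ≃ₗ[k] (Fin 5 → k), ∀ v, v 3 = 0 → v 4 = 0 → A v ∈ W := by
  obtain ⟨W', hWW'⟩ := Submodule.exists_isCompl W
  have hW' : Module.finrank k W' = 2 := by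
    have := Submodule.finrank_add_eq_of_isCompl hWW'
    rw [hW, Module.finrank_fin_fun] at this
    omega
  let e : (Fin 3 → k) ≃ₗ[k] W := LinearEquiv.ofFinrankEq _ _ (by rw [hW, Module.finrank_fin_fun])
  let e' : (Fin 2 → k) ≃ₗ[k] W' :=
    LinearEquiv.ofFinrankEq _ _ (by rw [hW', Module.finrank_fin_fun])
  let p : (Fin 5 → k) →ₗ[k] (Fin 3 → k) := LinearMap.funLeft k k ![0, 1, 2]
  let p' : (Fin 5 → k) →ₗ[k] (Fin 2 → k) := LinearMap.funLeft k k ![3, 4]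
  let A : (Fin 5 → k) →ₗ[k] (Fin 5 → k) :=
    W.subtype ∘ₗ e.toLinearMap ∘ₗ p + W'.subtype ∘ₗ e'.toLinearMap ∘ₗ p'
  have hA : ∀ v, A v = (e (p v) : Fin 5 → k) + (e' (p' v) : Fin 5 → k) := fun v => rfl
  have hinj : Function.Injective A := by
    rw [← LinearMap.ker_eq_bot, LinearMap.ker_eq_bot']
    intro v hv
    rw [hA] at hv
    have h1 : (e (p v) : Fin 5 → k) = 0 := by
      have : (e (p v) : Fin 5 → k) ∈ W ⊓ W' := by
        refine ⟨(e (p v)).2, ?_⟩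
        rw [eq_neg_of_add_eq_zero_left hv]
        exact W'.neg_mem (e' (p' v)).2
      rwa [hWW'.inf_eq_bot, Submodule.mem_bot] at this
    have h2 : (e' (p' v) : Fin 5 → k) = 0 := by rwa [h1, zero_add] at hv
    have h3 : p v = 0 := by simpa using h1
    have h4 : p' v = 0 := by simpa using h2
    funext i
    fin_cases i
    exacts [congrFun h3 0, congrFun h3 1, congrFun h3 2, congrFun h4 0, congrFun h4 1]
  refine ⟨LinearEquiv.ofInjectiveEndo A hinj, fun v h3 h4 => ?_⟩
  have h5 : p' v = 0 := by
    funext i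
    fin_cases i
    exacts [h3, h4]
  rw [LinearEquiv.coe_ofInjectiveEndo, hA, h5]
  simp

/-- The chain rule for polynomials. -/
theorem pderiv_aeval {ι κ : Type*} [Fintype κ] (g : κ → MvPolynomial ι k) (f : MvPolynomial κ k)
    (j : ι) : MvPolynomial.pderiv j (MvPolynomial.aeval g f) =
      ∑ i, MvPolynomial.aeval g (MvPolynomial.pderiv i f) * MvPolynomial.pderiv j (g i) := by
  classical
  induction f using MvPolynomial.induction_on with
  | C a => simp [MvPolynomial.algebraMap_eq]
  | add p q hp hq => simp only [map_add, hp, hq, add_mul, Finset.sum_add_distrib]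
  | mul_X p i hp =>
    simp only [map_mul, MvPolynomial.aeval_X, MvPolynomial.pderiv_mul, hp, map_add,
      MvPolynomial.pderiv_X, add_mul, Finset.sum_add_distrib, Finset.sum_mul]
    congr 1
    · refine Finset.sum_congr rfl fun l _ => ?_
      ring
    · rw [Finset.sum_eq_single i]
      · simp
      · intro l _ hl
        simp [hl]
      · simp

/-- A polynomial that vanishes where two coordinates vanish is in the ideal they generate. -/
theorem exists_eq_X_mul_add_X_mul [Infinite k] {ι : Type*} (i j : ι) (F : MvPolynomial ι k)
    (hF : ∀ v : ι → k, v i = 0 → v j = 0 → MvPolynomial.eval v F = 0) :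
    ∃ a b, F = MvPolynomial.X i * a + MvPolynomial.X j * b := by
  classical
  -- Setting both variables to zero changes a polynomial only by an element of the ideal they
  -- generate, and it sends `F` to 0.
  let g : ι → MvPolynomial ι k := fun l => if l = i ∨ l = j then 0 else MvPolynomial.X l
  have h0 : MvPolynomial.aeval g F = 0 := by
    refine MvPolynomial.funext fun v => ?_
    rw [eval_aeval, map_zero]
    exact hF _ (by simp [g]) (by simp [g])
  have h1 : ∀ F, F - MvPolynomial.aeval g F ∈
      Ideal.span {(MvPolynomial.X i : MvPolynomial ι k), MvPolynomial.X j} := by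
    intro F
    induction F using MvPolynomial.induction_on with
    | C a => simp [MvPolynomial.algebraMap_eq]
    | add p q hp hq =>
      rw [map_add, add_sub_add_comm]
      exact Ideal.add_mem _ hp hq
    | mul_X p l hp =>
      have : p * MvPolynomial.X l - MvPolynomial.aeval g (p * MvPolynomial.X l) =
          MvPolynomial.X l * (p - MvPolynomial.aeval g p) +
            MvPolynomial.aeval g p * (MvPolynomial.X l - g l) := by
        rw [map_mul, MvPolynomial.aeval_X]
        ring
      rw [this]
      refine Ideal.add_mem _ (Ideal.mul_mem_left _ _ hp) (Ideal.mul_mem_left _ _ ?_)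
      by_cases hl : l = i ∨ l = j
      · simp only [g, hl, if_true, sub_zero]
        exact Ideal.subset_span (by rcases hl with rfl | rfl <;> simp)
      · simp [g, hl]
  have h2 := h1 F
  rw [h0, sub_zero, Ideal.mem_span_pair] at h2
  obtain ⟨a, b, hab⟩ := h2
  exact ⟨a, b, by rw [← hab]; ring⟩

theorem homogeneousComponent_mul_of_isHomogeneous {ι : Type*} {p : MvPolynomial ι k} {m : ℕ}
    (hp : p.IsHomogeneous m) (n : ℕ) (a : MvPolynomial ι k) :
    MvPolynomial.homogeneousComponent (m + n) (p * a) =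
      p * MvPolynomial.homogeneousComponent n a := by
  conv_lhs => rw [← MvPolynomial.sum_homogeneousComponent a, Finset.mul_sum, map_sum]
  have : ∀ i, MvPolynomial.homogeneousComponent (m + n)
      (p * MvPolynomial.homogeneousComponent i a) =
        if i = n then p * MvPolynomial.homogeneousComponent i a else 0 := by
    intro i
    rw [MvPolynomial.homogeneousComponent_of_mem
      (hp.mul (MvPolynomial.homogeneousComponent_isHomogeneous i a))]
    congr 1
    simp [eq_comm]
  simp only [this, Finset.sum_ite_eq', Finset.mem_range]
  split_ifs with h
  · rfl
  · rw [MvPolynomial.homogeneousComponent_eq_zero _ _ (by omega), mul_zero]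

/-- A cubic form singular along `x₃ = x₄ = 0` is a quadratic form in `x₃` and `x₄` whose
coefficients are linear forms. -/
theorem exists_linear_coefficients [Infinite k] (F : MvPolynomial (Fin 5) k)
    (hF : F.IsHomogeneous 3)
    (h0 : ∀ v : Fin 5 → k, v 3 = 0 → v 4 = 0 → MvPolynomial.eval v F = 0)
    (h1 : ∀ (v : Fin 5 → k) (j : Fin 5), v 3 = 0 → v 4 = 0 →
      MvPolynomial.eval v (MvPolynomial.pderiv j F) = 0) :
    ∃ L : Fin 3 → (Fin 5 → k) →ₗ[k] k, ∀ v, MvPolynomial.eval v F =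
      L 0 v * v 3 ^ 2 + L 1 v * v 3 * v 4 + L 2 v * v 4 ^ 2 := by
  obtain ⟨a, b, hab⟩ := exists_eq_X_mul_add_X_mul 3 4 F h0
  -- On the plane the derivatives of `F` along x₃ and x₄ are `a` and `b`, so these lie in the same
  -- ideal.
  obtain ⟨a₁, a₂, ha⟩ := exists_eq_X_mul_add_X_mul 3 4 a fun v h3 h4 => by
    have := h1 v 3 h3 h4
    rw [hab] at this
    simpa [h3, h4, MvPolynomial.pderiv_mul, MvPolynomial.pderiv_X] using this
  obtain ⟨b₁, b₂, hb⟩ := exists_eq_X_mul_add_X_mul 3 4 b fun v h3 h4 => by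
    have := h1 v 4 h3 h4
    rw [hab] at this
    simpa [h3, h4, MvPolynomial.pderiv_mul, MvPolynomial.pderiv_X] using this
  have hX : ∀ i j : Fin 5, (MvPolynomial.X i * MvPolynomial.X j :
      MvPolynomial (Fin 5) k).IsHomogeneous 2 := fun i j =>
    (MvPolynomial.isHomogeneous_X k i).mul (MvPolynomial.isHomogeneous_X k j)
  have hF' : F = MvPolynomial.X 3 * MvPolynomial.X 3 * a₁ +
      MvPolynomial.X 3 * MvPolynomial.X 4 * (a₂ + b₁) +
      MvPolynomial.X 4 * MvPolynomial.X 4 * b₂ := by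
    rw [hab, ha, hb]
    ring
  -- The cofactors need not be homogeneous; as `F` has degree 3, only their components of degree one
  -- contribute.
  have hlin : ∀ p : MvPolynomial (Fin 5) k, ∃ l : (Fin 5 → k) →ₗ[k] k,
      ∀ v, MvPolynomial.eval v (MvPolynomial.homogeneousComponent 1 p) = l v := fun p =>
    exists_linearMap_of_homogeneous_one _ fun t v => by
      rw [eval_smul_of_isHomogeneous (MvPolynomial.homogeneousComponent_isHomogeneous 1 p), pow_one]
  choose l hl using hlin
  refine ⟨![l a₁, l (a₂ + b₁), l b₂], fun v => ?_⟩
  have hcomp := fun i j (p : MvPolynomial (Fin 5) k) =>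
    homogeneousComponent_mul_of_isHomogeneous (hX i j) 1 p
  norm_num only at hcomp
  rw [← MvPolynomial.homogeneousComponent_eq_self hF, hF',
    map_add (MvPolynomial.homogeneousComponent 3), map_add (MvPolynomial.homogeneousComponent 3),
    hcomp, hcomp, hcomp]
  simp only [map_add (MvPolynomial.eval v), map_mul, MvPolynomial.eval_X, hl]
  simp
  ring

/-- A cubic form whose hypersurface is singular along a plane is obtained from the form
`planeCubic` by a linear substitution. -/
theorem exists_eval_eq_eval_planeCubic [Infinite k] {f : MvPolynomial (Fin 5) k}
    (hf : f.IsHomogeneous 3) (hplane : ContainsPlane (singularLocus f)) :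
    ∃ D : (Fin 5 → k) →ₗ[k] (Fin 5 → k), ∀ u, MvPolynomial.eval u f =
      MvPolynomial.eval (D u) (planeCubic k) := by
  obtain ⟨W, hW, hsing⟩ := hplane
  obtain ⟨A, hA⟩ := exists_linearEquiv_mem_of_finrank_eq_three W hW
  have hval : ∀ u ∈ W, MvPolynomial.eval u f = 0 ∧
      ∀ i, MvPolynomial.eval u (MvPolynomial.pderiv i f) = 0 := by
    intro u hu
    have hpd : ∀ i, (MvPolynomial.pderiv i f).IsHomogeneous 2 := fun i => hf.pderiv
    by_cases hu0 : u = 0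
    · subst hu0
      refine ⟨?_, fun i => ?_⟩
      · simpa using eval_smul_of_isHomogeneous hf 0 0
      · simpa using eval_smul_of_isHomogeneous (hpd i) 0 0
    · obtain ⟨h1, h2⟩ := hsing (Projectivization.mk k u hu0) (by
        rw [Projectivization.submodule_mk, Submodule.span_singleton_le_iff_mem]
        exact hu)
      exact ⟨(mk_mem_hypersurface hf u hu0).1 h1,
        fun i => (eval_rep_mk_eq_zero_iff (hpd i) u hu0).1 (h2 i)⟩
  obtain ⟨L, hL⟩ := exists_linear_coefficients
    (MvPolynomial.aeval (linearForms (A : (Fin 5 → k) →ₗ[k] (Fin 5 → k))) f)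
    (by rw [← one_mul 3]; exact hf.aeval _ (isHomogeneous_linearForms _))
    (fun v h3 h4 => by
      simp only [eval_aeval, eval_linearForms]
      exact (hval _ (hA v h3 h4)).1)
    (fun v j h3 h4 => by
      rw [pderiv_aeval, map_sum]
      refine Finset.sum_eq_zero fun i _ => ?_
      rw [map_mul, eval_aeval]
      simp only [eval_linearForms]
      exact mul_eq_zero_of_left ((hval _ (hA v h3 h4)).2 i) _)
  -- In adapted coordinates the substitution is (L₀, L₁, L₂, x₃, x₄); it may be singular at this
  -- stage.
  refine ⟨LinearMap.pi ![L 0, L 1, L 2, LinearMap.proj 3, LinearMap.proj 4] ∘ₗ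
    (A.symm : (Fin 5 → k) →ₗ[k] (Fin 5 → k)), fun u => ?_⟩
  have := hL (A.symm u)
  simp only [eval_aeval, eval_linearForms, LinearEquiv.coe_coe, LinearEquiv.apply_symm_apply] at this
  rw [eval_planeCubic]
  exact this

/-- A form that is invariant under a translation defines a cone. -/
theorem isCone_of_translation_invariant {ι : Type*} {f : MvPolynomial ι k} {d : ℕ}
    (hf : f.IsHomogeneous d) (n : ι → k) (hn : n ≠ 0)
    (h : ∀ (s : k) u, MvPolynomial.eval (s • n + u) f = MvPolynomial.eval u f) :
    IsCone (hypersurface f) := by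
  refine ⟨Projectivization.mk k n hn, fun p hp q hq => ?_⟩
  rw [Projectivization.submodule_mk, Projectivization.submodule_eq p,
    Projectivization.submodule_eq q, Submodule.span_singleton_le_iff_mem,
    Submodule.mem_sup] at hq
  obtain ⟨x, hx, y, hy, hxy⟩ := hq
  obtain ⟨s, rfl⟩ := Submodule.mem_span_singleton.mp hx
  obtain ⟨t, rfl⟩ := Submodule.mem_span_singleton.mp hy
  change MvPolynomial.eval q.rep f = 0
  rw [← hxy, h, eval_smul_of_isHomogeneous hf, show MvPolynomial.eval p.rep f = 0 from hp,
    mul_zero]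

/-- A cubic threefold that is singular along a plane and is not a cone is projectively equivalent
to `planeCubicThreefold`. -/
theorem exists_linear_isomorphism_planeCubicThreefold [Infinite k] {f : MvPolynomial (Fin 5) k}
    (hf : f.IsHomogeneous 3) (hcone : ¬ IsCone (hypersurface f))
    (hplane : ContainsPlane (singularLocus f)) :
    ∃ φ : hypersurface f ≃ planeCubicThreefold k, IsBiregular φ ∧
        ∃ A : LinearMap.GeneralLinearGroup k (Fin 5 → k),
          ∀ p, (φ p : ℙ k (Fin 5 → k)) = A • p.1 := by
  obtain ⟨D, hD⟩ := exists_eval_eq_eval_planeCubic hf hplane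
  -- Translation by a kernel vector leaves the form unchanged, so that vector would be a vertex.
  have hinj : Function.Injective D := by
    rw [← LinearMap.ker_eq_bot]
    by_contra hker
    obtain ⟨n, hn, hn0⟩ := Submodule.exists_mem_ne_zero_of_ne_bot hker
    refine hcone (isCone_of_translation_invariant hf n hn0 fun s u => ?_)
    rw [hD, hD, map_add, map_smul, LinearMap.mem_ker.mp hn, smul_zero, zero_add]
  let A : LinearMap.GeneralLinearGroup k (Fin 5 → k) :=
    LinearMap.GeneralLinearGroup.ofLinearEquiv (LinearEquiv.ofInjectiveEndo D hinj)
  have hA : ∀ v : Fin 5 → k, A • v = D v := fun v => rfl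
  have mem : ∀ p : ℙ k (Fin 5 → k), A • p ∈ planeCubicThreefold k ↔ p ∈ hypersurface f := by
    intro p
    induction p using Projectivization.ind with
    | h v hv =>
      rw [Projectivization.smul_mk, planeCubicThreefold,
        mk_mem_hypersurface isHomogeneous_planeCubic, mk_mem_hypersurface hf, hA, hD]
  let φ : hypersurface f ≃ planeCubicThreefold k :=
    { toFun := fun p => ⟨A • p.1, (mem _).2 p.2⟩
      invFun := fun p => ⟨A⁻¹ • p.1, (mem _).1 (by rw [smul_inv_smul]; exact p.2)⟩
      left_inv := fun p => Subtype.ext (inv_smul_smul A p.1)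
      right_inv := fun p => Subtype.ext (smul_inv_smul A p.1) }
  exact ⟨φ, ⟨isRegularMap_of_linear φ A fun _ => rfl,
    isRegularMap_of_linear φ.symm A⁻¹ fun _ => rfl⟩, A, fun _ => rfl⟩

end PlaneSingular

end ClassicalVariety

/-! ### The theorem -/

theorem mainTheorem3 {k : Type*} [Field k] [IsAlgClosed k] [CharZero k] :
    -- A cubic threefold that is not a cone, is singular along a plane and has no singular point
    -- fixed by all automorphisms is isomorphic, by a linear change of coordinates, to the
    -- threefold `x₁x₄² + x₂x₄x₅ + x₃x₅² = 0`.
    (∀ f : MvPolynomial (Fin 5) k, IsCubicThreefold f → ¬ IsCone (hypersurface f) →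
      ContainsPlane (singularLocus f) → ¬ FixesSingularPoint f →
      ∃ φ : hypersurface f ≃ planeCubicThreefold k, IsBiregular φ ∧
        ∃ A : LinearMap.GeneralLinearGroup k (Fin 5 → k),
          ∀ p, (φ p : ℙ k (Fin 5 → k)) = A • p.1) ∧
    -- The action of every finite group of automorphisms of the latter is linearizable.
    (∀ G : Subgroup (VarAut (planeCubicThreefold k)), Finite G → IsLinearizable 3 G.subtype) ∧
    -- It is birational to `ℙ¹ × ℙ²`, equivariantly for its whole automorphism group, which acts
    -- there through linear representations `ρ` and `σ`; every finite group of automorphisms acts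
    -- generically freely on `ℙ²`.
    (∃ (ρ : VarAut (planeCubicThreefold k) →* LinearMap.GeneralLinearGroup k (Fin 2 → k))
        (σ : VarAut (planeCubicThreefold k) →* LinearMap.GeneralLinearGroup k (Fin 3 → k))
        (b : VarAut (planeCubicThreefold k) →* VarAut (segre k (Fin 2) (Fin 3)))
        (c : VarAut (planeCubicThreefold k) →* VarAut (Set.univ : Set (ℙ k (Fin 3 → k)))),
      IsProductProjectivization b ρ σ ∧ IsProjectivization c σ ∧
      EquivariantlyBirational (MonoidHom.id (VarAut (planeCubicThreefold k))) b ∧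
      ∀ G : Subgroup (VarAut (planeCubicThreefold k)), Finite G →
        IsGenericallyFree (c.comp G.subtype)) := by
  have : Infinite k := inferInstance
  obtain ⟨ρ, σ, hσ, h2, h⟩ := exists_representations (k := k)
  refine ⟨fun f hf hcone hplane _ =>
    exists_linear_isomorphism_planeCubicThreefold hf.1 hcone hplane, fun G hG => ?_,
    ρ, σ, productAction ρ σ, projectiveAction σ, isProductProjectivization_productAction ρ σ,
    isProjectivization_projectiveAction σ, equivariantlyBirational_productAction _ ρ σ h,
    fun G hG => ?_⟩
  · exact isLinearizable_of_finite G.subtype (ρ.comp G.subtype) (σ.comp G.subtype)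
      (hσ.comp G.subtype_injective) (fun g => h2 g) fun g => h g
  · exact isGenericallyFree_projectiveAction (σ.comp G.subtype) (hσ.comp G.subtype_injective)
      fun g => h2 g
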